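/- **Setting.** For $n\ge1$ and $1\le i\le n$ let $p_{n,i}>0$, $0<a_{n,i}<b_{n,i}$ with $a_{n,i}+b_{n,i}<1/2$, and $c_{n,i}\ge0$ with $a_{n,i}+c_{n,i}\le 1$. Let $K_{n,i}$ be the transition matrix on $\{0,1,\dots,2n\}$ given by $$K_{n,i}(j,j+1)=1-a_{n,i}\ (j\notin\{n,2n\}),\qquad K_{n,i}(0,0)=a_{n,i},\qquad K_{n,i}(j,j-1)=a_{n,i}\ (j\neq0),$$ $$K_{n,i}(n,n+1)=b_{n,i},\quad K_{n,i}(n,2n)=1-a_{n,i}-b_{n,i},\quad K_{n,i}(2n,n)=c_{n,i},\quad K_{n,i}(2n,2n)=1-a_{n,i}-c_{n,i}$$ (for $n=1$ the probabilities of parallel transitions are added), let $\pi_{n,i}$ be its stationary distribution, and assume that $K_{n,i}$ is reversible with respect to $\pi_{n,i}$. Put $q_n=\sum_{i=1}^np_{n,i}$ and $\hat p_n=\min_{1\le i\le n}p_{n,i}$, and let $\mathcal G=(\mathcal X_n,K_n,\pi_n)_{n\ge1}$, where $$\mathcal X_n=\{0,\dots,2n\}^n,\qquad \pi_n=\pi_{n,1}\times\dots\times\pi_{n,n},\qquad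 K_n=\sum_{i=1}^n\frac{p_{n,i}}{q_n}\,I\otimes\dots\otimes I\otimes K_{n,i}\otimes I\otimes\dots\otimes I$$ (with $K_{n,i}$ in the $i$-th place). Let $\mathcal G_c$ be the family of continuous time chains with kernels $H_{n,t}=e^{-t(I-K_n)}$ and total variation distances $$d_n(t)=\max_{x\in\mathcal X_n,\,A\subset\mathcal X_n}\{H_{n,t}(x,A)-\pi_n(A)\}.$$ Assume $$\sum_{i=1}^na_{n,i}=o(1/n),\qquad \max_{1\le i\le n}b_{n,i}=o(1),\qquad \max_{1\le i\le n}\frac{a_{n,i}}{b_{n,i}}=O(1/n).$$ An increasing sequence means a strictly increasing sequence $\xi=(\xi_k)_{k\ge1}$ of positive integers. The subfamily of $\mathcal G_c$ along $\xi$ has a *(total variation) cutoff with cutoff time* $t_k>0$ if $d_{\xi_k}(rt_k)\to0$ for all $r>1$ and $d_{\xi_k}(rt_k)\to1$ for all $0<r<1$, as $k\to\infty$; it has a cutoff if it has some cutoff time. The case $\xi_k=k$ is that of $\mathcal G_c$ itself. Put $B_n(\delta)=\sum_{i:\,p_{n,i}<(1+\delta)\hat p_n}b_{n,i}$, $\ \overline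 F_\xi(\delta)=\limsup_kB_{\xi_k}(\delta)$, $\ \underline F_\xi(\delta)=\liminf_kB_{\xi_k}(\delta)$, and $$\overline\Delta_0(\xi)=\sup\{\delta\in(0,1):\overline F_\xi(\delta)=0\},\qquad \overline\Delta_\infty(\xi)=\inf\{\delta\in(0,1):\overline F_\xi(\delta)=\infty\},$$ $$\underline\Delta_0(\xi)=\sup\{\delta\in(0,1):\underline F_\xi(\delta)=0\},\qquad \underline\Delta_\infty(\xi)=\inf\{\delta\in(0,1):\underline F_\xi(\delta)=\infty\},$$ with $\sup\emptyset=0$ and $\inf\emptyset=1$. Omit $\xi$ when $\xi_k=k$. **Claim.** (A) The following are equivalent: 1. for every increasing sequence $\xi$, $\overline\Delta_0(\xi)=\overline\Delta_\infty(\xi)$ and $\underline\Delta_0(\xi)=\underline\Delta_\infty(\xi)$; 2. for every increasing sequence $\xi$, $\overline\Delta_0(\xi)=\overline\Delta_\infty(\xi)$ or $\underline\Delta_0(\xi)=\underline\Delta_\infty(\xi)$; 3. $\mathcal G_c$ has a cutoff. In particular, if $\overline\Delta_0=\underline\Delta_\infty=\Delta$, then $\mathcal G_c$ has a cutoff with cutoff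 time $2(1+\Delta)^{-1}q_nn/\hat p_n$. The same cutoff time is valid if $\mathcal G_c$ has a cutoff and $\underline\Delta_0=\overline\Delta_\infty=\Delta$. (B) The following are equivalent: 1. for every increasing sequence $\xi$, $\overline\Delta_0(\xi)<\overline\Delta_\infty(\xi)$ and $\underline\Delta_0(\xi)<\underline\Delta_\infty(\xi)$; 2. for every increasing sequence $\xi$, $\overline\Delta_0(\xi)<\overline\Delta_\infty(\xi)$ or $\underline\Delta_0(\xi)<\underline\Delta_\infty(\xi)$; 3. no subfamily of $\mathcal G_c$ (along an increasing sequence) has a cutoff. -/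

import Mathlib

open Filter Topology Asymptotics
open scoped BigOperators

noncomputable section

/-- `π` is a stationary distribution of the transition matrix `K`: a probability vector with
`π K = π`. -/
def IsStationaryDistribution {X : Type*} [Fintype X] (K : Matrix X X ℝ) (π : X → ℝ) : Prop :=
  (∀ x, 0 ≤ π x) ∧ ∑ x, π x = 1 ∧ Matrix.vecMul π K = π

/-- Detailed balance of `K` with respect to `π`. -/
def IsReversibleChain {X : Type*} (K : Matrix X X ℝ) (π : X → ℝ) : Prop :=
  ∀ x y, π x * K x y = π y * K y x

/-- The transition matrix of the product chain with weights `w`: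
`∑ i, w i • (I ⊗ ⋯ ⊗ I ⊗ K i ⊗ I ⊗ ⋯ ⊗ I)`, the factor `K i` standing at the place `i`. -/
def productKernel {ι : Type*} [Fintype ι] [DecidableEq ι] {X : ι → Type*}
    [∀ i, DecidableEq (X i)] (w : ι → ℝ) (K : ∀ i, Matrix (X i) (X i) ℝ) :
    Matrix (∀ i, X i) (∀ i, X i) ℝ :=
  fun x y => ∑ i, w i * (K i (x i) (y i) *
    ∏ j ∈ Finset.univ.erase i, (1 : Matrix (X j) (X j) ℝ) (x j) (y j))

/-- The product of the distributions `π i`. -/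
def productDistribution {ι : Type*} [Fintype ι] {X : ι → Type*} (π : ∀ i, X i → ℝ) :
    (∀ i, X i) → ℝ :=
  fun x => ∏ i, π i (x i)

/-- The transition matrix `H_t = exp (-t (I - K))` of the continuous time chain associated
with `K`. -/
def continuousKernel {X : Type*} [Fintype X] [DecidableEq X] (K : Matrix X X ℝ) (t : ℝ) :
    Matrix X X ℝ :=
  NormedSpace.exp ((-t) • (1 - K))

/-- The (maximum) total variation `sup_{x, A} (H_t(x, A) - π(A))` of the continuous time chain
associated with `(X, K, π)`. -/
def continuousTV {X : Type*} [Fintype X] [DecidableEq X] (K : Matrix X X ℝ) (π : X → ℝ)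
    (t : ℝ) : ℝ :=
  ⨆ q : X × Finset X, (∑ y ∈ q.2, continuousKernel K t q.1 y - ∑ y ∈ q.2, π y)

/-- For a sequence `d` of distance functions in continuous time (the `k`-th one being
`t ↦ d k t`), the positive sequence `t` is a cutoff time. -/
def IsCutoffTime (d : ℕ → ℝ → ℝ) (t : ℕ → ℝ) : Prop :=
  (∀ k, 0 < t k) ∧
  (∀ r : ℝ, 1 < r → Tendsto (fun k => d k (r * t k)) atTop (𝓝 0)) ∧
  (∀ r : ℝ, 0 < r → r < 1 → Tendsto (fun k => d k (r * t k)) atTop (𝓝 1))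

/-- The sequence `d` of distance functions presents a cutoff. -/
def HasCutoff (d : ℕ → ℝ → ℝ) : Prop := ∃ t, IsCutoffTime d t

/-- The transition matrix on `{0, 1, …, 2n}` of the coordinate chains. Rightward steps
`j → j + 1` have probability `1 - a` for `j ≠ n`, leftward steps `j → j - 1` (and the loop at
`0`) have probability `a`; the state `n` moves to `n + 1` with probability `b` and to `2n` with
probability `1 - a - b`; the state `2n` moves to `n` with probability `c` and stays put with
probability `1 - a - c`. For `n = 1`, where `n + 1 = 2n` and `2n - 1 = n`, the probabilities of
parallel transitions add up. -/
def lacoinKernel (n : ℕ) (a b c : ℝ) : Matrix (Fin (2 * n + 1)) (Fin (2 * n + 1)) ℝ :=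
  fun j k =>
    (if k.val = j.val + 1 ∧ j.val ≠ n then 1 - a else 0)
    + (if j.val = 0 ∧ k.val = 0 then a else 0)
    + (if j.val = k.val + 1 then a else 0)
    + (if j.val = n ∧ k.val = n + 1 then b else 0)
    + (if j.val = n ∧ k.val = 2 * n then 1 - a - b else 0)
    + (if j.val = 2 * n ∧ k.val = n then c else 0)
    + (if j.val = 2 * n ∧ k.val = 2 * n then 1 - a - c else 0)

/-- `q_n = p_{n,1} + ⋯ + p_{n,n}`. -/
def lacoinQ (p : ∀ n : ℕ, Fin n → ℝ) (n : ℕ) : ℝ := ∑ i, p n i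

/-- `p̂_n = min_i p_{n,i}`. -/
def lacoinPhat (p : ∀ n : ℕ, Fin n → ℝ) (n : ℕ) : ℝ := ⨅ i, p n i

/-- The total variation `t ↦ d_{n,TV}^{(c)}(t)` of the `n`-th chain in `𝒢_c`, where `𝒢` is the
family of products of the `n` coordinate chains according to `(p_{n,i} / q_n)_i`. -/
def lacoinTV (p a b c : ∀ n : ℕ, Fin n → ℝ) (π : ∀ n : ℕ, Fin n → Fin (2 * n + 1) → ℝ)
    (n : ℕ) (t : ℝ) : ℝ :=
  continuousTV
    (productKernel (fun i => p n i / lacoinQ p n)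
      (fun i => lacoinKernel n (a n i) (b n i) (c n i)))
    (productDistribution (π n)) t

/-- `B_n(δ)`, the sum of `b_{n,i}` over those `i` with `p_{n,i} < (1 + δ) p̂_n`. -/
def lacoinB (p b : ∀ n : ℕ, Fin n → ℝ) (n : ℕ) (δ : ℝ) : ℝ :=
  ∑ i ∈ Finset.univ.filter (fun i => p n i < (1 + δ) * lacoinPhat p n), b n i

/-- `F̄_ξ(δ) = limsup_k B_{ξ_k}(δ)`, with values in the extended reals. -/
def upperF (p b : ∀ n : ℕ, Fin n → ℝ) (ξ : ℕ → ℕ) (δ : ℝ) : EReal :=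
  limsup (fun k => ((lacoinB p b (ξ k) δ : ℝ) : EReal)) atTop

/-- `F̲_ξ(δ) = liminf_k B_{ξ_k}(δ)`, with values in the extended reals. -/
def lowerF (p b : ∀ n : ℕ, Fin n → ℝ) (ξ : ℕ → ℕ) (δ : ℝ) : EReal :=
  liminf (fun k => ((lacoinB p b (ξ k) δ : ℝ) : EReal)) atTop

/-- `sup {δ ∈ (0,1) | F δ = 0}`, with `sup ∅ = 0`. -/
def thresholdZero (F : ℝ → EReal) : ℝ :=
  sSup (insert 0 {δ : ℝ | 0 < δ ∧ δ < 1 ∧ F δ = 0})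

/-- `inf {δ ∈ (0,1) | F δ = ∞}`, with `inf ∅ = 1`. -/
def thresholdInfty (F : ℝ → EReal) : ℝ :=
  sInf (insert 1 {δ : ℝ | 0 < δ ∧ δ < 1 ∧ F δ = ⊤})

/-- An increasing sequence of positive integers. -/
def IsSubsequence (ξ : ℕ → ℕ) : Prop := StrictMono ξ ∧ ∀ k, 1 ≤ ξ k

end

/-- Distance functions `d k`, in normalised time, governed by the counting functions `B k`. -/
structure IsCutoffProfile (d B : ℕ → ℝ → ℝ) : Prop where
  anti : ∀ k s t, 0 ≤ s → s ≤ t → d k t ≤ d k s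
  nonneg : ∀ k s, 0 ≤ s → 0 ≤ d k s
  le_one : ∀ k s, 0 ≤ s → d k s ≤ 1
  mono : ∀ k, Monotone (B k)
  nonneg_B : ∀ k δ, 0 ≤ B k δ
  zero_B : ∀ k, B k 0 = 0
  early : ∀ s, 0 < s → s < 1 → Tendsto (fun k => d k s) atTop (𝓝 1)
  upper : ∀ s δ, 1 < s → 2 < s * (1 + δ) → ∃ e : ℕ → ℝ, Tendsto e atTop (𝓝 0) ∧
    ∀ᶠ k in atTop, d k s ≤ 1 - Real.exp (-(2 * B k δ)) * (1 - e k)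
  lower : ∀ s δ, 0 < s → s * (1 + δ) < 2 → ∃ e : ℕ → ℝ, Tendsto e atTop (𝓝 0) ∧
    ∀ᶠ k in atTop, 1 - e k - Real.exp (-(B k δ / 2)) ≤ d k s

/-- `B k δ` tends to `0` below the threshold `Δ` and to infinity above it. -/
structure HasSharpThreshold (B : ℕ → ℝ → ℝ) (Δ : ℝ) : Prop where
  nonneg : 0 ≤ Δ
  le_one : Δ ≤ 1
  below : ∀ δ, 0 < δ → δ < Δ → Tendsto (fun k => B k δ) atTop (𝓝 0)
  above : ∀ δ, Δ < δ → δ < 1 → Tendsto (fun k => B k δ) atTop atTop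

theorem IsCutoffProfile.comp {d B : ℕ → ℝ → ℝ} (h : IsCutoffProfile d B) {φ : ℕ → ℕ}
    (hφ : Tendsto φ atTop atTop) :
    IsCutoffProfile (fun k => d (φ k)) (fun k => B (φ k)) where
  anti k := h.anti _
  nonneg k := h.nonneg _
  le_one k := h.le_one _
  mono k := h.mono _
  nonneg_B k := h.nonneg_B _
  zero_B k := h.zero_B _
  early s h0 h1 := (h.early s h0 h1).comp hφ
  upper s δ h0 h1 := by
    obtain ⟨e, he, hd⟩ := h.upper s δ h0 h1
    exact ⟨fun k => e (φ k), he.comp hφ, hφ.eventually hd⟩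
  lower s δ h0 h1 := by
    obtain ⟨e, he, hd⟩ := h.lower s δ h0 h1
    exact ⟨fun k => e (φ k), he.comp hφ, hφ.eventually hd⟩

theorem IsCutoffProfile.tendsto_zero {d B : ℕ → ℝ → ℝ} (h : IsCutoffProfile d B) {s δ : ℝ}
    (hs : 1 < s) (hδ : 2 < s * (1 + δ)) (hB : Tendsto (fun k => B k δ) atTop (𝓝 0)) :
    Tendsto (fun k => d k s) atTop (𝓝 0) := by
  obtain ⟨e, he, hd⟩ := h.upper s δ hs hδ
  have h1 : Tendsto (fun k => 1 - Real.exp (-(2 * B k δ)) * (1 - e k)) atTop (𝓝 0) := by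
    have h2 : Tendsto (fun k => Real.exp (-(2 * B k δ))) atTop (𝓝 (Real.exp (-(2 * 0)))) :=
      (Real.continuous_exp.tendsto _).comp ((hB.const_mul 2).neg)
    have h3 := (h2.mul (he.const_sub 1)).const_sub 1
    simpa using h3
  exact tendsto_of_tendsto_of_tendsto_of_le_of_le' tendsto_const_nhds h1
    (Eventually.of_forall fun k => h.nonneg k s (by linarith)) hd

theorem IsCutoffProfile.tendsto_one {d B : ℕ → ℝ → ℝ} (h : IsCutoffProfile d B) {s δ : ℝ}
    (hs : 0 < s) (hδ : s * (1 + δ) < 2) (hB : Tendsto (fun k => B k δ) atTop atTop) :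
    Tendsto (fun k => d k s) atTop (𝓝 1) := by
  obtain ⟨e, he, hd⟩ := h.lower s δ hs hδ
  have h1 : Tendsto (fun k => 1 - e k - Real.exp (-(B k δ / 2))) atTop (𝓝 1) := by
    have h2 : Tendsto (fun k => Real.exp (-(B k δ / 2))) atTop (𝓝 0) :=
      Real.tendsto_exp_neg_atTop_nhds_zero.comp (hB.atTop_div_const two_pos)
    simpa using (he.const_sub 1).sub h2
  exact tendsto_of_tendsto_of_tendsto_of_le_of_le' h1 tendsto_const_nhds hd
    (Eventually.of_forall fun k => h.le_one k s hs.le)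

theorem IsCutoffProfile.isCutoffTime {d B : ℕ → ℝ → ℝ} (h : IsCutoffProfile d B) {Δ : ℝ}
    (hB : HasSharpThreshold B Δ) {s : ℕ → ℝ} (hs0 : ∀ k, 0 < s k)
    (hs : Tendsto s atTop (𝓝 (2 / (1 + Δ)))) : IsCutoffTime d s := by
  have hΔ0 := hB.nonneg
  have hΔ1 := hB.le_one
  have hpos : 0 < 2 / (1 + Δ) := by positivity
  have hone : 1 ≤ 2 / (1 + Δ) := by rw [le_div_iff₀ (by linarith)]; linarith
  refine ⟨hs0, fun r hr => ?_, fun r hr0 hr1 => ?_⟩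
  · obtain ⟨s', h1, h2⟩ := exists_between (show 2 / (1 + Δ) < r * (2 / (1 + Δ)) by nlinarith)
    have hs'pos : 0 < s' := hpos.trans h1
    have h3 : 2 < s' * (1 + Δ) := by rwa [div_lt_iff₀ (by linarith)] at h1
    have h4 : Tendsto (fun k => d k s') atTop (𝓝 0) := by
      rcases hΔ0.eq_or_lt with h0 | h0
      -- For `Δ = 0` no positive level lies below the threshold; the level `0` serves, where `B`
      -- vanishes.
      · refine h.tendsto_zero (δ := 0) (by linarith) (by simpa [← h0] using h3) ?_
        simp [h.zero_B]
      · have h5 : 2 / s' - 1 < Δ := by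
          rw [sub_lt_iff_lt_add, div_lt_iff₀ hs'pos]; linarith
        obtain ⟨δ, h6, h7⟩ := exists_between (max_lt h0 h5)
        rw [max_lt_iff] at h6
        refine h.tendsto_zero (δ := δ) (by linarith) ?_ (hB.below δ h6.1 h7)
        have := h6.2
        rw [sub_lt_iff_lt_add, div_lt_iff₀ hs'pos] at this
        linarith
    refine tendsto_of_tendsto_of_tendsto_of_le_of_le' tendsto_const_nhds h4 ?_ ?_
    · exact Eventually.of_forall fun k => h.nonneg k _ (mul_nonneg (by linarith) (hs0 k).le)
    · filter_upwards [(hs.const_mul r).eventually (lt_mem_nhds h2)] with k hk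
      exact h.anti k _ _ hs'pos.le hk.le
  · obtain ⟨s', h1, h2⟩ := exists_between (show r * (2 / (1 + Δ)) < 2 / (1 + Δ) by nlinarith)
    have hs'pos : 0 < s' := lt_trans (by positivity) h1
    have h3 : s' * (1 + Δ) < 2 := by rwa [lt_div_iff₀ (by linarith)] at h2
    have h4 : Tendsto (fun k => d k s') atTop (𝓝 1) := by
      -- Times below `1` need no information on `B`. From `s' ≥ 1` one gets `2 / s' - 1 ≤ 1`, so the
      -- level chosen above `Δ` stays below `1`.
      rcases lt_or_ge s' 1 with h0 | h0
      · exact h.early s' hs'pos h0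
      · have h5 : Δ < 2 / s' - 1 := by
          rw [lt_sub_iff_add_lt, lt_div_iff₀ hs'pos]; linarith
        have h8 : 2 / s' - 1 ≤ 1 := by
          rw [sub_le_iff_le_add, div_le_iff₀ hs'pos]; linarith
        obtain ⟨δ, h6, h7⟩ := exists_between h5
        refine h.tendsto_one (δ := δ) hs'pos ?_ (hB.above δ h6 (by linarith))
        rw [lt_sub_iff_add_lt, lt_div_iff₀ hs'pos] at h7
        linarith
    refine tendsto_of_tendsto_of_tendsto_of_le_of_le' h4 tendsto_const_nhds ?_ ?_
    · filter_upwards [(hs.const_mul r).eventually (gt_mem_nhds h1)] with k hk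
      exact h.anti k _ _ (mul_nonneg (by linarith) (hs0 k).le) hk.le
    · exact Eventually.of_forall fun k => h.le_one k _ (mul_nonneg (by linarith) (hs0 k).le)

/-- A counting function staying away from `0` and `∞` on an interval prevents a cutoff. -/
theorem IsCutoffProfile.not_hasCutoff {d B : ℕ → ℝ → ℝ} (h : IsCutoffProfile d B)
    {δ₁ δ₂ ε M : ℝ} (h0 : 0 < δ₁) (h12 : δ₁ < δ₂) (h2 : δ₂ < 1) (hε : 0 < ε)
    (hf : ∃ᶠ k in atTop, ε ≤ B k δ₁ ∧ B k δ₂ ≤ M) : ¬ HasCutoff d := by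
  rintro ⟨t, ht0, ht1, ht2⟩
  -- Three times `u < m < v` inside the window. At `u` the distance stays below `1` by a fixed
  -- amount, at `v` it stays above `0` by a fixed amount, for infinitely many `k`. If `t k ≤ m`,
  -- then `(v / m) * t k ≤ v`, where the distance should be almost `0`; otherwise `(u / m) * t k ≥
  -- u`, where it should be almost `1`.
  obtain ⟨u, hu1, hu2⟩ := exists_between
    (show 2 / (1 + δ₂) < 2 / (1 + δ₁) from
      div_lt_div_of_pos_left two_pos (by linarith) (by linarith))
  obtain ⟨v, hv1, hv2⟩ := exists_between hu2
  obtain ⟨m, hm1, hm2⟩ := exists_between hv1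
  have hone : 1 < 2 / (1 + δ₂) := by rw [lt_div_iff₀ (by linarith)]; linarith
  have hu3 : 2 < u * (1 + δ₂) := by rwa [div_lt_iff₀ (by linarith)] at hu1
  have hv3 : v * (1 + δ₁) < 2 := by rwa [lt_div_iff₀ (by linarith)] at hv2
  obtain ⟨e, he, hde⟩ := h.upper u δ₂ (by linarith) hu3
  obtain ⟨e', he', hde'⟩ := h.lower v δ₁ (by linarith) hv3
  have hmpos : 0 < m := by linarith
  have hr1 := ht1 (v / m) (by rw [lt_div_iff₀ hmpos]; linarith)
  have hr2 := ht2 (u / m) (div_pos (by linarith) hmpos) (by rw [div_lt_iff₀ hmpos]; linarith)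
  have hexp : Real.exp (-(ε / 2)) < 1 := by rw [Real.exp_lt_one_iff]; linarith
  have hpos := Real.exp_pos (-(2 * M))
  set α := 1 - Real.exp (-(ε / 2)) with hα
  set β := Real.exp (-(2 * M)) with hβ
  have E1 := he.eventually (gt_mem_nhds (show (0 : ℝ) < 1 / 2 by norm_num))
  have E2 := he'.eventually (gt_mem_nhds (show (0 : ℝ) < α / 2 by linarith))
  have E3 := hr1.eventually (gt_mem_nhds (show (0 : ℝ) < α / 2 by linarith))
  have E4 := hr2.eventually (lt_mem_nhds (show 1 - β / 2 < 1 by linarith))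
  obtain ⟨k, ⟨hk1, hk2⟩, hkd, hkd', e1, e2, e3, e4⟩ :=
    (hf.and_eventually (hde.and (hde'.and (E1.and (E2.and (E3.and E4)))))).exists
  rcases le_total (t k) m with hk | hk
  · have h5 : d k v ≤ d k (v / m * t k) := by
      apply h.anti k _ _ (mul_nonneg (div_nonneg (by linarith) hmpos.le) (ht0 k).le)
      rw [div_mul_eq_mul_div, div_le_iff₀ hmpos]
      exact mul_le_mul_of_nonneg_left hk (by linarith)
    have h6 : Real.exp (-(B k δ₁ / 2)) ≤ Real.exp (-(ε / 2)) :=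
      Real.exp_le_exp.2 (by linarith)
    linarith
  · have h5 : d k (u / m * t k) ≤ d k u := by
      apply h.anti k _ _ (by linarith)
      rw [div_mul_eq_mul_div, le_div_iff₀ hmpos]
      exact mul_le_mul_of_nonneg_left hk (by linarith)
    have h6 : β ≤ Real.exp (-(2 * B k δ₂)) := Real.exp_le_exp.2 (by linarith)
    nlinarith

/-! ### Thresholds of monotone functions -/

theorem thresholdZero_nonneg (F : ℝ → EReal) : 0 ≤ thresholdZero F := by
  refine le_csSup ⟨1, ?_⟩ (Set.mem_insert _ _)
  rintro x (rfl | hx)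
  exacts [zero_le_one, hx.2.1.le]

theorem thresholdInfty_le_one (F : ℝ → EReal) : thresholdInfty F ≤ 1 := by
  refine csInf_le ⟨0, ?_⟩ (Set.mem_insert _ _)
  rintro x (rfl | hx)
  exacts [zero_le_one, hx.1.le]

theorem thresholdZero_le_of {F : ℝ → EReal} {x : ℝ} (hx : 0 ≤ x)
    (h : ∀ δ, 0 < δ → δ < 1 → F δ = 0 → δ ≤ x) : thresholdZero F ≤ x := by
  refine csSup_le (Set.insert_nonempty _ _) ?_
  rintro y (rfl | hy)
  exacts [hx, h y hy.1 hy.2.1 hy.2.2]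

theorem le_thresholdInfty_of {F : ℝ → EReal} {x : ℝ} (hx : x ≤ 1)
    (h : ∀ δ, 0 < δ → δ < 1 → F δ = ⊤ → x ≤ δ) : x ≤ thresholdInfty F := by
  refine le_csInf (Set.insert_nonempty _ _) ?_
  rintro y (rfl | hy)
  exacts [hx, h y hy.1 hy.2.1 hy.2.2]

theorem le_thresholdZero {F : ℝ → EReal} {δ : ℝ} (h0 : 0 < δ) (h1 : δ < 1) (h : F δ = 0) :
    δ ≤ thresholdZero F := by
  refine le_csSup ⟨1, ?_⟩ (Set.mem_insert_of_mem _ ⟨h0, h1, h⟩)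
  rintro x (rfl | hx)
  exacts [zero_le_one, hx.2.1.le]

theorem thresholdInfty_le {F : ℝ → EReal} {δ : ℝ} (h0 : 0 < δ) (h1 : δ < 1) (h : F δ = ⊤) :
    thresholdInfty F ≤ δ := by
  refine csInf_le ⟨0, ?_⟩ (Set.mem_insert_of_mem _ ⟨h0, h1, h⟩)
  rintro x (rfl | hx)
  exacts [zero_le_one, hx.1.le]

theorem thresholdZero_le_thresholdInfty {F : ℝ → EReal} (hF : Monotone F) :
    thresholdZero F ≤ thresholdInfty F := by
  refine le_thresholdInfty_of (thresholdZero_le_of zero_le_one fun δ _ h _ => h.le) ?_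
  intro δ h0 _ h
  refine thresholdZero_le_of h0.le fun δ' _ _ h' => ?_
  by_contra! hlt
  have := hF hlt.le
  rw [h, h'] at this
  simp at this

theorem eq_zero_of_lt_thresholdZero {F : ℝ → EReal} (hF : Monotone F) (h0 : ∀ δ, 0 ≤ F δ)
    {δ : ℝ} (hδ0 : 0 < δ) (hδ : δ < thresholdZero F) : F δ = 0 := by
  obtain ⟨y, hy, hlt⟩ := exists_lt_of_lt_csSup (Set.insert_nonempty _ _) hδ
  rcases hy with rfl | hy
  · exact absurd hlt hδ0.not_gt
  · exact le_antisymm ((hF hlt.le).trans hy.2.2.le) (h0 δ)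

theorem eq_top_of_thresholdInfty_lt {F : ℝ → EReal} (hF : Monotone F)
    {δ : ℝ} (hδ1 : δ < 1) (hδ : thresholdInfty F < δ) : F δ = ⊤ := by
  obtain ⟨y, hy, hlt⟩ := exists_lt_of_csInf_lt (Set.insert_nonempty _ _) hδ
  rcases hy with rfl | hy
  · exact absurd hlt hδ1.not_gt
  · exact top_le_iff.1 (hy.2.2.ge.trans (hF hlt.le))

/-! ### Extracting sharp thresholds from upper and lower limits -/

/-- The pointwise upper limit of a sequence of real functions. -/
noncomputable def limsupFun (B : ℕ → ℝ → ℝ) (δ : ℝ) : EReal :=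
  limsup (fun k => ((B k δ : ℝ) : EReal)) atTop

/-- The pointwise lower limit of a sequence of real functions. -/
noncomputable def liminfFun (B : ℕ → ℝ → ℝ) (δ : ℝ) : EReal :=
  liminf (fun k => ((B k δ : ℝ) : EReal)) atTop

section limits

variable {B : ℕ → ℝ → ℝ} (hmono : ∀ k, Monotone (B k)) (hnonneg : ∀ k δ, 0 ≤ B k δ)

theorem liminfFun_le_limsupFun (B : ℕ → ℝ → ℝ) (δ : ℝ) : liminfFun B δ ≤ limsupFun B δ :=
  liminf_le_limsup

include hmono in
theorem limsupFun_mono : Monotone (limsupFun B) := fun _ _ h =>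
  limsup_le_limsup (Eventually.of_forall fun k => EReal.coe_le_coe_iff.2 (hmono k h))

include hmono in
theorem liminfFun_mono : Monotone (liminfFun B) := fun _ _ h =>
  liminf_le_liminf (Eventually.of_forall fun k => EReal.coe_le_coe_iff.2 (hmono k h))

include hnonneg in
theorem liminfFun_nonneg (δ : ℝ) : 0 ≤ liminfFun B δ :=
  le_liminf_of_le (h := Eventually.of_forall fun k => EReal.coe_nonneg.2 (hnonneg k δ))

include hnonneg in
theorem limsupFun_nonneg (δ : ℝ) : 0 ≤ limsupFun B δ :=
  (liminfFun_nonneg hnonneg δ).trans (liminfFun_le_limsupFun B δ)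

include hnonneg in
theorem tendsto_zero_of_limsupFun_eq_zero {δ : ℝ} (h : limsupFun B δ = 0) :
    Tendsto (fun k => B k δ) atTop (𝓝 0) := by
  have : Tendsto (fun k => ((B k δ : ℝ) : EReal)) atTop (𝓝 ((0 : ℝ) : EReal)) :=
    tendsto_of_le_liminf_of_limsup_le (EReal.coe_zero ▸ liminfFun_nonneg hnonneg δ)
      (EReal.coe_zero ▸ h.le)
  exact EReal.tendsto_coe.1 this

theorem tendsto_atTop_of_liminfFun_eq_top {δ : ℝ} (h : liminfFun B δ = ⊤) :
    Tendsto (fun k => B k δ) atTop atTop := by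
  have : Tendsto (fun k => ((B k δ : ℝ) : EReal)) atTop (𝓝 ⊤) :=
    tendsto_of_le_liminf_of_limsup_le h.ge le_top
  exact EReal.tendsto_coe_nhds_top_iff.1 this

-- A vanishing upper limit is already convergence to `0` along the whole sequence. An infinite one
-- only says that `B` is large infinitely often, so a subsequence is extracted diagonally along
-- levels decreasing to `Δ`; monotonicity then covers each fixed level above `Δ`.
include hmono hnonneg in
theorem exists_hasSharpThreshold_of_limsup
    (h : thresholdZero (limsupFun B) = thresholdInfty (limsupFun B)) :
    ∃ φ : ℕ → ℕ, StrictMono φ ∧ ∃ Δ, HasSharpThreshold (fun k => B (φ k)) Δ := by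
  set Δ := thresholdInfty (limsupFun B) with hΔ
  have h0 : 0 ≤ Δ := h ▸ thresholdZero_nonneg _
  have h1 : Δ ≤ 1 := thresholdInfty_le_one _
  have hbelow : ∀ δ, 0 < δ → δ < Δ → Tendsto (fun k => B k δ) atTop (𝓝 0) := fun δ hδ0 hδ =>
    tendsto_zero_of_limsupFun_eq_zero hnonneg (eq_zero_of_lt_thresholdZero (limsupFun_mono hmono)
      (limsupFun_nonneg hnonneg) hδ0 (h ▸ hδ))
  rcases h1.eq_or_lt with h1' | h1'
  · exact ⟨id, strictMono_id, Δ, h0, h1, hbelow, fun δ h2 h3 => by linarith⟩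
  -- The `+ 2` keeps the level `Δ + (1 - Δ) / (m + 2)` strictly between `Δ` and `1`, also for `m =
  -- 0`.
  have hpos : ∀ m : ℕ, 0 < (1 - Δ) / ((m : ℝ) + 2) := fun m =>
    div_pos (by linarith) (by positivity)
  have hsmall : ∀ m : ℕ, (1 - Δ) / ((m : ℝ) + 2) < 1 - Δ := fun m =>
    div_lt_self (by linarith) (by linarith [(Nat.cast_nonneg m : (0 : ℝ) ≤ m)])
  have hfreq : ∀ m : ℕ, ∃ᶠ k in atTop, (m : ℝ) < B k (Δ + (1 - Δ) / ((m : ℝ) + 2)) := by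
    intro m
    have h3 : limsupFun B (Δ + (1 - Δ) / ((m : ℝ) + 2)) = ⊤ :=
      eq_top_of_thresholdInfty_lt (limsupFun_mono hmono) (by linarith [hsmall m])
        (by linarith [hpos m])
    have h4 : ((m : ℝ) : EReal) < limsupFun B (Δ + (1 - Δ) / ((m : ℝ) + 2)) :=
      h3 ▸ EReal.coe_lt_top _
    exact (frequently_lt_of_lt_limsup (h := h4)).mono fun k hk => EReal.coe_lt_coe_iff.1 hk
  obtain ⟨φ, hφ, hBφ⟩ := extraction_forall_of_frequently hfreq
  refine ⟨φ, hφ, Δ, h0, h1, fun δ h2 h3 => (hbelow δ h2 h3).comp hφ.tendsto_atTop,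
    fun δ h2 h3 => ?_⟩
  refine tendsto_atTop_mono' _ ?_ tendsto_natCast_atTop_atTop
  have hlim : Tendsto (fun m : ℕ => (1 - Δ) / ((m : ℝ) + 2)) atTop (𝓝 0) :=
    tendsto_const_nhds.div_atTop (tendsto_atTop_add_const_right _ _ tendsto_natCast_atTop_atTop)
  filter_upwards [hlim.eventually (gt_mem_nhds (sub_pos.2 h2))] with m hm
  exact (hBφ m).le.trans (hmono _ (by linarith))

-- The mirror image: an infinite lower limit is convergence, and the diagonal extraction runs along
-- levels increasing to `Δ`, at which `B` is small infinitely often.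
include hmono hnonneg in
theorem exists_hasSharpThreshold_of_liminf
    (h : thresholdZero (liminfFun B) = thresholdInfty (liminfFun B)) :
    ∃ φ : ℕ → ℕ, StrictMono φ ∧ ∃ Δ, HasSharpThreshold (fun k => B (φ k)) Δ := by
  set Δ := thresholdInfty (liminfFun B) with hΔ
  have h0 : 0 ≤ Δ := h ▸ thresholdZero_nonneg _
  have h1 : Δ ≤ 1 := thresholdInfty_le_one _
  have habove : ∀ δ, Δ < δ → δ < 1 → Tendsto (fun k => B k δ) atTop atTop := fun δ hδ hδ1 =>
    tendsto_atTop_of_liminfFun_eq_top (eq_top_of_thresholdInfty_lt (liminfFun_mono hmono) hδ1 hδ)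
  rcases h0.eq_or_lt with h0' | h0'
  · exact ⟨id, strictMono_id, Δ, h0, h1, fun δ h2 h3 => by linarith, habove⟩
  have hpos : ∀ m : ℕ, 0 < Δ / ((m : ℝ) + 2) := fun m => by positivity
  have hsmall : ∀ m : ℕ, Δ / ((m : ℝ) + 2) < Δ := fun m =>
    div_lt_self (by linarith) (by linarith [(Nat.cast_nonneg m : (0 : ℝ) ≤ m)])
  have hfreq : ∀ m : ℕ, ∃ᶠ k in atTop, B k (Δ - Δ / ((m : ℝ) + 2)) < 1 / ((m : ℝ) + 1) := by
    intro m
    have h3 : liminfFun B (Δ - Δ / ((m : ℝ) + 2)) = 0 :=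
      eq_zero_of_lt_thresholdZero (liminfFun_mono hmono) (liminfFun_nonneg hnonneg)
        (by linarith [hsmall m]) (h.symm ▸ sub_lt_self _ (hpos m))
    have h4 : liminfFun B (Δ - Δ / ((m : ℝ) + 2)) < ((1 / ((m : ℝ) + 1) : ℝ) : EReal) :=
      h3 ▸ EReal.coe_pos.2 (by positivity)
    exact (frequently_lt_of_liminf_lt (h := h4)).mono fun k hk => EReal.coe_lt_coe_iff.1 hk
  obtain ⟨φ, hφ, hBφ⟩ := extraction_forall_of_frequently hfreq
  refine ⟨φ, hφ, Δ, h0, h1, fun δ h2 h3 => ?_,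
    fun δ h2 h3 => (habove δ h2 h3).comp hφ.tendsto_atTop⟩
  have hlim : Tendsto (fun m : ℕ => Δ / ((m : ℝ) + 2)) atTop (𝓝 0) :=
    tendsto_const_nhds.div_atTop (tendsto_atTop_add_const_right _ _ tendsto_natCast_atTop_atTop)
  refine tendsto_of_tendsto_of_tendsto_of_le_of_le' tendsto_const_nhds
    tendsto_one_div_add_atTop_nhds_zero_nat (Eventually.of_forall fun m => hnonneg _ _) ?_
  filter_upwards [hlim.eventually (gt_mem_nhds (sub_pos.2 h3))] with m hm
  exact (hmono _ (by linarith)).trans (hBφ m).le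

-- Here both limits are genuine along the whole sequence, so no extraction is needed.
include hmono hnonneg in
theorem hasSharpThreshold_of_outer {Δ : ℝ} (h0 : thresholdZero (limsupFun B) = Δ)
    (h1 : thresholdInfty (liminfFun B) = Δ) : HasSharpThreshold B Δ where
  nonneg := h0 ▸ thresholdZero_nonneg _
  le_one := h1 ▸ thresholdInfty_le_one _
  below _ hδ0 hδ := tendsto_zero_of_limsupFun_eq_zero hnonneg
    (eq_zero_of_lt_thresholdZero (limsupFun_mono hmono) (limsupFun_nonneg hnonneg) hδ0 (h0 ▸ hδ))
  above _ hδ hδ1 := tendsto_atTop_of_liminfFun_eq_top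
    (eq_top_of_thresholdInfty_lt (liminfFun_mono hmono) hδ1 (h1 ▸ hδ))

end limits

/-! ### A cutoff closes the gap between the thresholds -/

theorem IsCutoffProfile.limsup_thresholds_eq {d B : ℕ → ℝ → ℝ} (h : IsCutoffProfile d B)
    (hc : HasCutoff d) : thresholdZero (limsupFun B) = thresholdInfty (limsupFun B) := by
  refine (thresholdZero_le_thresholdInfty (limsupFun_mono h.mono)).eq_or_lt.resolve_right
    fun hlt => ?_
  obtain ⟨δ₁, h1, h2⟩ := exists_between hlt
  obtain ⟨δ₂, h3, h4⟩ := exists_between h2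
  have hδ0 : 0 < δ₁ := (thresholdZero_nonneg _).trans_lt h1
  have hδ1 : δ₂ < 1 := h4.trans_le (thresholdInfty_le_one _)
  have hF1 : 0 < limsupFun B δ₁ := (limsupFun_nonneg h.nonneg_B δ₁).lt_of_ne fun h5 =>
    (le_thresholdZero hδ0 (h3.trans hδ1) h5.symm).not_gt h1
  have hF2 : limsupFun B δ₂ < ⊤ := lt_top_iff_ne_top.2 fun h5 =>
    (thresholdInfty_le (hδ0.trans h3) hδ1 h5).not_gt h4
  obtain ⟨ε, hε0, hε⟩ := EReal.lt_iff_exists_real_btwn.1 hF1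
  obtain ⟨M, hM, -⟩ := EReal.lt_iff_exists_real_btwn.1 hF2
  refine h.not_hasCutoff hδ0 h3 hδ1 (EReal.coe_pos.1 hε0) (M := M) ?_ hc
  -- The lower bound holds infinitely often and the upper bound eventually; for the lower limit
  -- these roles are exchanged. Either way both hold infinitely often.
  refine ((frequently_lt_of_lt_limsup (h := hε)).and_eventually
    (eventually_lt_of_limsup_lt (h := hM))).mono fun k hk => ?_
  exact ⟨(EReal.coe_lt_coe_iff.1 hk.1).le, (EReal.coe_lt_coe_iff.1 hk.2).le⟩

theorem IsCutoffProfile.liminf_thresholds_eq {d B : ℕ → ℝ → ℝ} (h : IsCutoffProfile d B)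
    (hc : HasCutoff d) : thresholdZero (liminfFun B) = thresholdInfty (liminfFun B) := by
  refine (thresholdZero_le_thresholdInfty (liminfFun_mono h.mono)).eq_or_lt.resolve_right
    fun hlt => ?_
  obtain ⟨δ₁, h1, h2⟩ := exists_between hlt
  obtain ⟨δ₂, h3, h4⟩ := exists_between h2
  have hδ0 : 0 < δ₁ := (thresholdZero_nonneg _).trans_lt h1
  have hδ1 : δ₂ < 1 := h4.trans_le (thresholdInfty_le_one _)
  have hF1 : 0 < liminfFun B δ₁ := (liminfFun_nonneg h.nonneg_B δ₁).lt_of_ne fun h5 =>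
    (le_thresholdZero hδ0 (h3.trans hδ1) h5.symm).not_gt h1
  have hF2 : liminfFun B δ₂ < ⊤ := lt_top_iff_ne_top.2 fun h5 =>
    (thresholdInfty_le (hδ0.trans h3) hδ1 h5).not_gt h4
  obtain ⟨ε, hε0, hε⟩ := EReal.lt_iff_exists_real_btwn.1 hF1
  obtain ⟨M, hM, -⟩ := EReal.lt_iff_exists_real_btwn.1 hF2
  refine h.not_hasCutoff hδ0 h3 hδ1 (EReal.coe_pos.1 hε0) (M := M) ?_ hc
  refine ((frequently_lt_of_liminf_lt (h := hM)).and_eventually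
    (eventually_lt_of_lt_liminf (h := hε))).mono fun k hk => ?_
  exact ⟨(EReal.coe_lt_coe_iff.1 hk.2).le, (EReal.coe_lt_coe_iff.1 hk.1).le⟩

/-! ### Cutoff from sharp thresholds along subsequences -/

/-- The first level at which the counting function `b` reaches `1`. -/
noncomputable def crossingLevel (b : ℝ → ℝ) : ℝ :=
  sInf (insert 1 {δ : ℝ | 0 < δ ∧ δ < 1 ∧ 1 ≤ b δ})

theorem crossingLevel_nonneg (b : ℝ → ℝ) : 0 ≤ crossingLevel b := by
  refine le_csInf (Set.insert_nonempty _ _) ?_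
  rintro y (rfl | hy)
  exacts [zero_le_one, hy.1.le]

theorem crossingLevel_le_one (b : ℝ → ℝ) : crossingLevel b ≤ 1 := by
  refine csInf_le ⟨0, ?_⟩ (Set.mem_insert _ _)
  rintro x (rfl | hx)
  exacts [zero_le_one, hx.1.le]

/-- The crossing level is read off from each `B k` alone and finds the threshold whenever there is
one. It thus supplies a single candidate cutoff time even if different subsequences have different
thresholds. -/
theorem HasSharpThreshold.tendsto_crossingLevel {B : ℕ → ℝ → ℝ} {Δ : ℝ}
    (h : HasSharpThreshold B Δ) (hmono : ∀ k, Monotone (B k)) :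
    Tendsto (fun k => crossingLevel (B k)) atTop (𝓝 Δ) := by
  refine tendsto_order.2 ⟨fun x hx => ?_, fun x hx => ?_⟩
  · rcases lt_or_ge x 0 with h0 | h0
    · exact Eventually.of_forall fun k => h0.trans_le (crossingLevel_nonneg _)
    · obtain ⟨y, hy1, hy2⟩ := exists_between hx
      filter_upwards [(h.below y (by linarith) hy2).eventually (gt_mem_nhds one_pos)] with k hk
      refine hy1.trans_le (le_csInf (Set.insert_nonempty _ _) ?_)
      rintro w (rfl | hw)
      · linarith [h.le_one]
      · by_contra! hlt
        linarith [hmono k hlt.le, hw.2.2]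
  · rcases lt_or_ge 1 x with h1 | h1
    · exact Eventually.of_forall fun k => (crossingLevel_le_one _).trans_lt h1
    · obtain ⟨y, hy1, hy2⟩ := exists_between hx
      filter_upwards [(h.above y hy1 (by linarith)).eventually_ge_atTop 1] with k hk
      refine lt_of_le_of_lt (csInf_le ⟨0, ?_⟩ (Set.mem_insert_of_mem _
        ⟨h.nonneg.trans_lt hy1, by linarith, hk⟩)) hy2
      rintro x (rfl | hx)
      exacts [zero_le_one, hx.1.le]

theorem IsCutoffProfile.hasCutoff_of_subseq {d B : ℕ → ℝ → ℝ} (h : IsCutoffProfile d B)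
    (hsub : ∀ φ : ℕ → ℕ, StrictMono φ →
      ∃ ψ : ℕ → ℕ, StrictMono ψ ∧ ∃ Δ, HasSharpThreshold (fun k => B (φ (ψ k))) Δ) :
    HasCutoff d := by
  -- Convergence may be tested on a further subsequence of any given one, and there the candidate `2
  -- / (1 + crossingLevel (B k))` converges to the right limit.
  have key : ∀ ns : ℕ → ℕ, Tendsto ns atTop atTop → ∃ ms : ℕ → ℕ,
      IsCutoffTime (fun k => d (ns (ms k)))
        (fun k => 2 / (1 + crossingLevel (B (ns (ms k))))) := by
    intro ns hns
    obtain ⟨φ, -, hφ⟩ := strictMono_subseq_of_tendsto_atTop hns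
    obtain ⟨ψ, hψ, Δ, hΔ⟩ := hsub _ hφ
    refine ⟨fun k => φ (ψ k), ?_⟩
    refine IsCutoffProfile.isCutoffTime
      (h.comp (φ := fun k => ns (φ (ψ k))) (hφ.tendsto_atTop.comp hψ.tendsto_atTop)) hΔ
      (fun k => ?_) ?_
    · have := crossingLevel_nonneg (B (ns (φ (ψ k))))
      positivity
    · refine tendsto_const_nhds.div ?_ (by linarith [hΔ.nonneg])
      exact (hΔ.tendsto_crossingLevel fun k => h.mono _).const_add 1
  refine ⟨fun k => 2 / (1 + crossingLevel (B k)), fun k => ?_, fun r hr => ?_, fun r h0 h1 => ?_⟩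
  · have := crossingLevel_nonneg (B k)
    positivity
  · refine tendsto_of_subseq_tendsto fun ns hns => ?_
    obtain ⟨ms, hms⟩ := key ns hns
    exact ⟨ms, hms.2.1 r hr⟩
  · refine tendsto_of_subseq_tendsto fun ns hns => ?_
    obtain ⟨ms, hms⟩ := key ns hns
    exact ⟨ms, hms.2.2 r h0 h1⟩

/-! ### Continuous time chains as Poisson mixtures -/

section generalChains

variable {X : Type*} [Fintype X] [DecidableEq X]

theorem continuousKernel_zero (K : Matrix X X ℝ) : continuousKernel K 0 = 1 := by
  simp [continuousKernel]

theorem continuousKernel_add (K : Matrix X X ℝ) (s t : ℝ) :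
    continuousKernel K (s + t) = continuousKernel K s * continuousKernel K t := by
  unfold continuousKernel
  rw [← Matrix.exp_add_of_commute, ← add_smul]
  · congr 2; ring
  · exact ((Commute.refl _).smul_left _).smul_right _

/-- The identity commutes with `K`, so `exp (-t (1 - K)) = exp (-t) exp (t K)`: the chain makes a
Poisson number of discrete steps. -/
theorem hasSum_continuousKernel (K : Matrix X X ℝ) (t : ℝ) (x y : X) :
    HasSum (fun m : ℕ => Real.exp (-t) * (t ^ m / m.factorial) * (K ^ m) x y)
      (continuousKernel K t x y) := by
  have h1 : continuousKernel K t = Real.exp (-t) • NormedSpace.exp (t • K) := by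
    have h2 : (-t) • (1 - K) = (-t) • (1 : Matrix X X ℝ) + t • K := by
      rw [smul_sub, neg_smul, neg_smul, sub_neg_eq_add]
    have h3 : NormedSpace.exp ((-t) • (1 : Matrix X X ℝ)) = Real.exp (-t) • 1 := by
      rw [← Matrix.diagonal_one, ← Matrix.diagonal_smul, Matrix.exp_diagonal,
        ← Matrix.diagonal_smul]
      congr 1
      ext i
      rw [Pi.coe_exp]
      simp [Real.exp_eq_exp_ℝ]
    rw [continuousKernel, h2, Matrix.exp_add_of_commute, h3, smul_one_mul]
    exact ((Commute.one_left _).smul_left _).smul_right _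
  have h4 : HasSum (fun m : ℕ => ((m.factorial : ℝ)⁻¹) • (t • K) ^ m)
      (NormedSpace.exp (t • K)) := by
    let _ : NormedRing (Matrix X X ℝ) := Matrix.linftyOpNormedRing
    let _ : NormedAlgebra ℝ (Matrix X X ℝ) := Matrix.linftyOpNormedAlgebra
    exact NormedSpace.exp_series_hasSum_exp' (𝕂 := ℝ) (t • K)
  have h5 : HasSum (fun m : ℕ => (((m.factorial : ℝ)⁻¹) • (t • K) ^ m) x y)
      (NormedSpace.exp (t • K) x y) := Pi.hasSum.1 (Pi.hasSum.1 h4 x) y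
  rw [h1, Matrix.smul_apply, smul_eq_mul]
  refine (h5.mul_left (Real.exp (-t))).congr_fun fun m => ?_
  simp only [Matrix.smul_apply, smul_pow, smul_eq_mul]
  ring

theorem hasSum_poisson_pow (t r : ℝ) :
    HasSum (fun m : ℕ => Real.exp (-t) * (t ^ m / m.factorial) * r ^ m)
      (Real.exp (-(t * (1 - r)))) := by
  have h := (NormedSpace.expSeries_div_hasSum_exp (t * r)).mul_left (Real.exp (-t))
  rw [← Real.exp_eq_exp_ℝ, ← Real.exp_add] at h
  convert! h using 1
  · ext m; rw [mul_pow]; ring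
  · congr 1; ring

/-- A row stochastic matrix. -/
def IsStochastic (K : Matrix X X ℝ) : Prop :=
  (∀ x y, 0 ≤ K x y) ∧ ∀ x, ∑ y, K x y = 1

namespace IsStochastic

variable {K : Matrix X X ℝ}

omit [DecidableEq X] in
theorem mul {L : Matrix X X ℝ} (hK : IsStochastic K) (hL : IsStochastic L) :
    IsStochastic (K * L) := by
  refine ⟨fun x y => ?_, fun x => ?_⟩
  · exact Finset.sum_nonneg fun z _ => mul_nonneg (hK.1 _ _) (hL.1 _ _)
  · simp_rw [Matrix.mul_apply]
    rw [Finset.sum_comm]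
    simp_rw [← Finset.mul_sum, hL.2, mul_one, hK.2]

theorem one : IsStochastic (1 : Matrix X X ℝ) :=
  ⟨fun x y => by rw [Matrix.one_apply]; split_ifs <;> norm_num, fun x => by simp [Matrix.one_apply]⟩

theorem pow (hK : IsStochastic K) (m : ℕ) : IsStochastic (K ^ m) := by
  induction m with
  | zero => simpa using one
  | succ m ih => rw [pow_succ]; exact ih.mul hK

omit [DecidableEq X] in
theorem le_one (hK : IsStochastic K) (x y : X) : K x y ≤ 1 :=
  hK.2 x ▸ Finset.single_le_sum (fun z _ => hK.1 x z) (Finset.mem_univ y)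

theorem continuousKernel (hK : IsStochastic K) {t : ℝ} (ht : 0 ≤ t) :
    IsStochastic (continuousKernel K t) := by
  refine ⟨fun x y => ?_, fun x => ?_⟩
  · refine (hasSum_continuousKernel K t x y).nonneg fun m => ?_
    exact mul_nonneg (mul_nonneg (Real.exp_pos _).le (by positivity)) ((hK.pow m).1 _ _)
  · have h1 := hasSum_sum fun y (_ : y ∈ Finset.univ) => hasSum_continuousKernel K t x y
    have h2 := hasSum_poisson_pow t 1
    simp_rw [← Finset.mul_sum, (hK.pow _).2 x] at h1
    simp only [one_pow, sub_self, mul_zero, neg_zero, Real.exp_zero] at h2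
    exact h1.unique h2

end IsStochastic

/-- Bounds by differences of geometric sequences survive Poisson averaging in closed form; this
transfers path counting in discrete time to continuous time. -/
theorem le_continuousKernel_of_pow {K : Matrix X X ℝ} {x y : X} {α β r₁ r₂ t : ℝ} (ht : 0 ≤ t)
    (h : ∀ m : ℕ, α * r₁ ^ m - β * r₂ ^ m ≤ (K ^ m) x y) :
    α * Real.exp (-(t * (1 - r₁))) - β * Real.exp (-(t * (1 - r₂))) ≤
      continuousKernel K t x y := by
  refine hasSum_le (fun m => ?_) (((hasSum_poisson_pow t r₁).mul_left α).sub
    ((hasSum_poisson_pow t r₂).mul_left β)) (hasSum_continuousKernel K t x y)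
  have := mul_le_mul_of_nonneg_left (h m)
    (mul_nonneg (Real.exp_pos (-t)).le (show 0 ≤ t ^ m / m.factorial by positivity))
  linarith

theorem le_one_sub_continuousKernel_of_pow {K : Matrix X X ℝ} {x y : X} {α β r₁ r₂ t : ℝ}
    (ht : 0 ≤ t) (h : ∀ m : ℕ, α * r₁ ^ m - β * r₂ ^ m ≤ 1 - (K ^ m) x y) :
    α * Real.exp (-(t * (1 - r₁))) - β * Real.exp (-(t * (1 - r₂))) ≤
      1 - continuousKernel K t x y := by
  have h1 := hasSum_poisson_pow t 1
  simp only [one_pow, sub_self, mul_zero, neg_zero, Real.exp_zero, mul_one] at h1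
  refine hasSum_le (fun m => ?_) (((hasSum_poisson_pow t r₁).mul_left α).sub
    ((hasSum_poisson_pow t r₂).mul_left β)) (h1.sub (hasSum_continuousKernel K t x y))
  have := mul_le_mul_of_nonneg_left (h m)
    (mul_nonneg (Real.exp_pos (-t)).le (show 0 ≤ t ^ m / m.factorial by positivity))
  linarith

/-- If `y` is reached with good probability after `N` steps, then it is reached with good
probability at times well above `N`. -/
theorem le_continuousKernel_of_steps {K : Matrix X X ℝ} (hK : IsStochastic K) {x y : X} {N : ℕ}
    {α ρ θ t : ℝ} (ht : 0 ≤ t) (hθ : 0 ≤ θ) (hα : 0 ≤ α) (h0 : 0 ≤ ρ) (h1 : ρ ≤ 1)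
    (h : ∀ m, N ≤ m → α * ρ ^ m ≤ (K ^ m) x y) :
    α * (Real.exp (-(t * (1 - ρ))) - Real.exp (N * θ - t * (1 - Real.exp (-θ)))) ≤
      continuousKernel K t x y := by
  -- Chernoff's device: the indicator of `m ≥ N` is at least `1 - exp ((N - m) θ)`, which is
  -- nonpositive for `m ≤ N` and turns the bound into a difference of geometric sequences.
  refine le_trans ?_ (le_continuousKernel_of_pow (α := α) (β := α * Real.exp (N * θ)) (r₁ := ρ)
    (r₂ := ρ * Real.exp (-θ)) ht fun m => ?_)
  · have h2 : Real.exp (N * θ) * Real.exp (-(t * (1 - ρ * Real.exp (-θ)))) ≤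
        Real.exp (N * θ - t * (1 - Real.exp (-θ))) := by
      rw [← Real.exp_add, Real.exp_le_exp]
      have : t * (ρ * Real.exp (-θ)) ≤ t * Real.exp (-θ) :=
        mul_le_mul_of_nonneg_left (mul_le_of_le_one_left (Real.exp_pos _).le h1) ht
      linarith
    have := mul_le_mul_of_nonneg_left h2 hα
    linarith
  · have h2 : α * ρ ^ m - α * Real.exp (N * θ) * (ρ * Real.exp (-θ)) ^ m =
        α * ρ ^ m * (1 - Real.exp (N * θ - m * θ)) := by
      rw [mul_pow, ← Real.exp_nat_mul, sub_eq_add_neg (N * θ : ℝ), Real.exp_add]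
      ring_nf
    have h3 : 0 ≤ α * ρ ^ m := by positivity
    rw [h2]
    rcases le_total N m with hm | hm
    · refine le_trans ?_ (h m hm)
      exact mul_le_of_le_one_right h3 (by linarith [Real.exp_pos (N * θ - m * θ)])
    · refine le_trans ?_ ((hK.pow m).1 x y)
      refine mul_nonpos_of_nonneg_of_nonpos h3 (sub_nonpos.2 (Real.one_le_exp ?_))
      have : (m : ℝ) ≤ N := Nat.cast_le.2 hm
      nlinarith

/-- If `y` is missed with good probability before `N` steps, then it is missed with good
probability at times well below `N`. -/
theorem le_one_sub_continuousKernel_of_steps {K : Matrix X X ℝ} (hK : IsStochastic K) {x y : X}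
    {N : ℕ} {α ρ θ t : ℝ} (ht : 0 ≤ t) (hθ : 0 ≤ θ) (hα : 0 ≤ α) (h0 : 0 ≤ ρ) (h1 : ρ ≤ 1)
    (h : ∀ m, m < N → α * ρ ^ m ≤ 1 - (K ^ m) x y) :
    α * (Real.exp (-(t * (1 - ρ))) - Real.exp (t * (Real.exp θ - 1) - N * θ)) ≤
      1 - continuousKernel K t x y := by
  -- The same device for the other tail: the indicator of `m < N` is at least `1 - exp ((m - N) θ)`.
  refine le_trans ?_ (le_one_sub_continuousKernel_of_pow (α := α)
    (β := α * Real.exp (-(N * θ))) (r₁ := ρ) (r₂ := ρ * Real.exp θ) ht fun m => ?_)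
  · have h2 : Real.exp (-(N * θ)) * Real.exp (-(t * (1 - ρ * Real.exp θ))) ≤
        Real.exp (t * (Real.exp θ - 1) - N * θ) := by
      rw [← Real.exp_add, Real.exp_le_exp]
      have : t * (ρ * Real.exp θ) ≤ t * Real.exp θ :=
        mul_le_mul_of_nonneg_left (mul_le_of_le_one_left (Real.exp_pos _).le h1) ht
      linarith
    have := mul_le_mul_of_nonneg_left h2 hα
    linarith
  · have h2 : α * ρ ^ m - α * Real.exp (-(N * θ)) * (ρ * Real.exp θ) ^ m =
        α * ρ ^ m * (1 - Real.exp (m * θ - N * θ)) := by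
      rw [mul_pow, ← Real.exp_nat_mul, sub_eq_add_neg (m * θ : ℝ), Real.exp_add]
      ring_nf
    have h3 : 0 ≤ α * ρ ^ m := by positivity
    rw [h2]
    rcases lt_or_ge m N with hm | hm
    · refine le_trans ?_ (h m hm)
      exact mul_le_of_le_one_right h3 (by linarith [Real.exp_pos (m * θ - N * θ)])
    · refine le_trans ?_ (sub_nonneg.2 ((hK.pow m).le_one x y))
      refine mul_nonpos_of_nonneg_of_nonpos h3 (sub_nonpos.2 (Real.one_le_exp ?_))
      have : (N : ℝ) ≤ m := Nat.cast_le.2 hm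
      nlinarith

theorem IsReversibleChain.pow {K : Matrix X X ℝ} {π : X → ℝ} (h : IsReversibleChain K π) (m : ℕ) :
    IsReversibleChain (K ^ m) π := by
  induction m with
  | zero =>
    intro x y
    rcases eq_or_ne x y with rfl | hxy
    · rfl
    · simp [hxy, hxy.symm]
  | succ m ih =>
    intro x y
    rw [pow_succ, Matrix.mul_apply, ← pow_succ, pow_succ', Matrix.mul_apply, Finset.mul_sum,
      Finset.mul_sum]
    refine Finset.sum_congr rfl fun z _ => ?_
    linear_combination K z y * ih x z + (K ^ m) z x * h z y

theorem IsReversibleChain.continuousKernel {K : Matrix X X ℝ} {π : X → ℝ}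
    (h : IsReversibleChain K π) (t : ℝ) : IsReversibleChain (continuousKernel K t) π := by
  intro x y
  refine ((hasSum_continuousKernel K t x y).mul_left (π x)).unique ?_
  refine ((hasSum_continuousKernel K t y x).mul_left (π y)).congr_fun fun m => ?_
  linear_combination (Real.exp (-t) * (t ^ m / m.factorial)) * h.pow m x y

/-- Return probabilities of a reversible chain in continuous time dominate the stationary
distribution. -/
theorem le_continuousKernel_self {K : Matrix X X ℝ} {π : X → ℝ} (hK : IsStochastic K)
    (h : IsReversibleChain K π) (h0 : ∀ x, 0 ≤ π x) (h1 : ∑ x, π x = 1) {z : X} (hz : 0 < π z)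
    {t : ℝ} (ht : 0 ≤ t) : π z ≤ continuousKernel K t z z := by
  have hs := hK.continuousKernel (div_nonneg ht two_pos.le)
  have hr := h.continuousKernel (t / 2)
  have h2 : continuousKernel K t z z =
      ∑ y, continuousKernel K (t / 2) z y * continuousKernel K (t / 2) y z := by
    rw [← Matrix.mul_apply, ← continuousKernel_add, add_halves]
  -- Cauchy–Schwarz against `π`. By reversibility `g y` plays the role of `H (z, y) ^ 2 / π y` with
  -- `H` the kernel at time `t / 2`; dividing by `π z` instead avoids assuming `π y` positive.
  have h3 := Finset.sum_sq_le_sum_mul_sum_of_sq_le_mul Finset.univ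
    (r := fun y => continuousKernel K (t / 2) z y) (f := π)
    (g := fun y => continuousKernel K (t / 2) z y * continuousKernel K (t / 2) y z / π z)
    (fun y _ => h0 y) (fun y _ => div_nonneg (mul_nonneg (hs.1 _ _) (hs.1 _ _)) hz.le)
    (fun y _ => by
      refine le_of_eq ?_
      rw [mul_div_assoc', eq_div_iff hz.ne']
      linear_combination continuousKernel K (t / 2) z y * hr z y)
  rw [hs.2, h1, ← Finset.sum_div, ← h2] at h3
  rw [one_pow, one_mul, le_div_iff₀ hz, one_mul] at h3
  exact h3

/-- The probability of being at `z` at a later time. -/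
theorem mul_le_continuousKernel_add {K : Matrix X X ℝ} (hK : IsStochastic K) (x z : X) {s t : ℝ}
    (hs : 0 ≤ s) (ht : 0 ≤ t) :
    continuousKernel K s x z * continuousKernel K t z z ≤ continuousKernel K (s + t) x z := by
  rw [continuousKernel_add, Matrix.mul_apply]
  exact Finset.single_le_sum (f := fun y => continuousKernel K s x y * continuousKernel K t y z)
    (fun y _ => mul_nonneg ((hK.continuousKernel hs).1 _ _)
    ((hK.continuousKernel ht).1 _ _)) (Finset.mem_univ z)

theorem IsStationaryDistribution.pow {K : Matrix X X ℝ} {π : X → ℝ}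
    (h : IsStationaryDistribution K π) (m : ℕ) : Matrix.vecMul π (K ^ m) = π := by
  induction m with
  | zero => simp
  | succ m ih => rw [pow_succ, ← Matrix.vecMul_vecMul, ih, h.2.2]

theorem IsStationaryDistribution.continuousKernel {K : Matrix X X ℝ} {π : X → ℝ}
    (h : IsStationaryDistribution K π) (t : ℝ) (z : X) :
    ∑ x, π x * continuousKernel K t x z = π z := by
  have h1 := hasSum_sum fun x (_ : x ∈ Finset.univ) =>
    (hasSum_continuousKernel K t x z).mul_left (π x)
  have h2 := (hasSum_poisson_pow t 1).mul_left (π z)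
  simp only [one_pow, sub_self, mul_zero, neg_zero, Real.exp_zero, mul_one] at h2
  refine h1.unique (h2.congr_fun fun m => ?_)
  have h3 := congrFun (h.pow m) z
  simp only [Matrix.vecMul, dotProduct] at h3
  rw [← h3, Finset.sum_mul]
  exact Finset.sum_congr rfl fun x _ => by ring

/-- Stationarity writes `π z` as an average over the starting points, so uniform arrival bounds also
bound the stationary mass. -/
theorem IsStationaryDistribution.le_of_forall {K : Matrix X X ℝ} {π : X → ℝ}
    (h : IsStationaryDistribution K π) {t β : ℝ} {z : X}
    (hβ : ∀ x, β ≤ _root_.continuousKernel K t x z) : β ≤ π z := by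
  rw [← h.continuousKernel t z, ← one_mul β, ← h.2.1, Finset.sum_mul]
  exact Finset.sum_le_sum fun x _ => mul_le_mul_of_nonneg_left (hβ x) (h.1 x)

section TV

variable {K : Matrix X X ℝ} {π : X → ℝ}

theorem le_continuousTV (K : Matrix X X ℝ) (π : X → ℝ) (t : ℝ) (x : X) (A : Finset X) :
    ∑ y ∈ A, continuousKernel K t x y - ∑ y ∈ A, π y ≤ continuousTV K π t :=
  le_ciSup (f := fun q : X × Finset X =>
    ∑ y ∈ q.2, continuousKernel K t q.1 y - ∑ y ∈ q.2, π y)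
    (Set.finite_range _).bddAbove (x, A)

theorem continuousTV_le [Nonempty X] {t β : ℝ}
    (h : ∀ x A, ∑ y ∈ A, continuousKernel K t x y - ∑ y ∈ A, π y ≤ β) :
    continuousTV K π t ≤ β :=
  ciSup_le fun q => h q.1 q.2

theorem continuousTV_nonneg [Nonempty X] (K : Matrix X X ℝ) (π : X → ℝ) (t : ℝ) :
    0 ≤ continuousTV K π t := by
  simpa using le_continuousTV K π t (Classical.arbitrary X) ∅

theorem continuousTV_le_one [Nonempty X] (hK : IsStochastic K) (h0 : ∀ x, 0 ≤ π x) {t : ℝ}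
    (ht : 0 ≤ t) : continuousTV K π t ≤ 1 := by
  refine continuousTV_le fun x A => ?_
  have h1 : ∑ y ∈ A, continuousKernel K t x y ≤ 1 := (hK.continuousKernel ht).2 x ▸
    Finset.sum_le_univ_sum_of_nonneg fun y => (hK.continuousKernel ht).1 x y
  linarith [Finset.sum_nonneg fun y (_ : y ∈ A) => h0 y]

/-- The law after the longer time is a mixture of laws after the shorter one, started at the random
position reached meanwhile. -/
theorem continuousTV_anti [Nonempty X] (hK : IsStochastic K) {s t : ℝ}
    (hst : s ≤ t) : continuousTV K π t ≤ continuousTV K π s := by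
  refine continuousTV_le fun x A => ?_
  obtain ⟨u, hu, rfl⟩ : ∃ u, 0 ≤ u ∧ t = u + s := ⟨t - s, by linarith, by ring⟩
  have h1 := hK.continuousKernel hu
  rw [continuousKernel_add]
  simp_rw [Matrix.mul_apply]
  rw [Finset.sum_comm]
  simp_rw [← Finset.mul_sum]
  calc ∑ z, continuousKernel K u x z * ∑ y ∈ A, continuousKernel K s z y - ∑ y ∈ A, π y
      = ∑ z, continuousKernel K u x z *
          (∑ y ∈ A, continuousKernel K s z y - ∑ y ∈ A, π y) := by
        simp_rw [mul_sub, Finset.sum_sub_distrib, ← Finset.sum_mul, h1.2 x, one_mul]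
    _ ≤ ∑ z, continuousKernel K u x z * continuousTV K π s :=
        Finset.sum_le_sum fun z _ => mul_le_mul_of_nonneg_left
          (le_continuousTV K π s z A) (h1.1 x z)
    _ = continuousTV K π s := by rw [← Finset.sum_mul, h1.2 x, one_mul]

/-- Two laws that both charge `z` with mass at least `β` overlap there: a set containing `z` has
`π`-mass at least `β`, and any other set misses mass `β` of the chain. -/
theorem continuousTV_le_of_forall [Nonempty X] (hK : IsStochastic K) (h0 : ∀ x, 0 ≤ π x)
    {t β : ℝ} (ht : 0 ≤ t) (z : X) (hπ : β ≤ π z) (hβ : ∀ x, β ≤ continuousKernel K t x z) :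
    continuousTV K π t ≤ 1 - β := by
  refine continuousTV_le fun x A => ?_
  have h1 := hK.continuousKernel ht
  by_cases hz : z ∈ A
  · have h2 : ∑ y ∈ A, continuousKernel K t x y ≤ 1 := h1.2 x ▸
      Finset.sum_le_univ_sum_of_nonneg fun y => h1.1 x y
    have h3 : π z ≤ ∑ y ∈ A, π y := Finset.single_le_sum (fun y _ => h0 y) hz
    linarith
  · have h2 : ∑ y ∈ insert z A, continuousKernel K t x y ≤ 1 := h1.2 x ▸
      Finset.sum_le_univ_sum_of_nonneg fun y => h1.1 x y
    rw [Finset.sum_insert hz] at h2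
    have h3 : 0 ≤ ∑ y ∈ A, π y := Finset.sum_nonneg fun y _ => h0 y
    linarith [hβ x]

theorem sub_le_continuousTV (hK : IsStochastic K) (h1 : ∑ x, π x = 1) {t : ℝ} (ht : 0 ≤ t)
    (x z : X) : π z - continuousKernel K t x z ≤ continuousTV K π t := by
  have h2 := le_continuousTV K π t x (Finset.univ.erase z)
  have h3 := Finset.sum_erase_add Finset.univ (continuousKernel K t x) (Finset.mem_univ z)
  have h4 := Finset.sum_erase_add Finset.univ π (Finset.mem_univ z)
  rw [(hK.continuousKernel ht).2 x] at h3
  linarith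

end TV

end generalChains

/-! ### Independence of the coordinates of a product chain -/

section productChains

variable {ι : Type*} [Fintype ι] [DecidableEq ι] {X : ι → Type*}

/-- The tensor product of the matrices `M i`. -/
def tensorMatrix (M : ∀ i, Matrix (X i) (X i) ℝ) : Matrix (∀ i, X i) (∀ i, X i) ℝ :=
  fun x y => ∏ i, M i (x i) (y i)

theorem tensorMatrix_mul [∀ i, Fintype (X i)] (M N : ∀ i, Matrix (X i) (X i) ℝ) :
    tensorMatrix M * tensorMatrix N = tensorMatrix fun i => M i * N i := by
  ext x y
  simp only [tensorMatrix, Matrix.mul_apply, Finset.prod_univ_sum, ← Finset.prod_mul_distrib,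
    Fintype.piFinset_univ]

omit [DecidableEq ι] in
theorem tensorMatrix_one [∀ i, DecidableEq (X i)] :
    tensorMatrix (fun i => (1 : Matrix (X i) (X i) ℝ)) = 1 := by
  ext x y
  rcases eq_or_ne x y with rfl | h
  · simp [tensorMatrix]
  · obtain ⟨i, hi⟩ := Function.ne_iff.1 h
    rw [Matrix.one_apply_ne h]
    exact Finset.prod_eq_zero (Finset.mem_univ i) (Matrix.one_apply_ne hi)

theorem tensorMatrix_update (M : ∀ i, Matrix (X i) (X i) ℝ) (i : ι) (A : Matrix (X i) (X i) ℝ)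
    (x y : ∀ i, X i) :
    tensorMatrix (Function.update M i A) x y =
      A (x i) (y i) * ∏ j ∈ Finset.univ.erase i, M j (x j) (y j) := by
  rw [tensorMatrix, ← Finset.mul_prod_erase _ _ (Finset.mem_univ i), Function.update_self]
  congr 1
  refine Finset.prod_congr rfl fun j hj => ?_
  rw [Function.update_of_ne (Finset.ne_of_mem_erase hj)]

theorem productKernel_eq_sum [∀ i, DecidableEq (X i)] (w : ι → ℝ)
    (K : ∀ i, Matrix (X i) (X i) ℝ) :
    productKernel w K = ∑ i, w i • tensorMatrix (Function.update (fun _ => 1) i (K i)) := by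
  ext x y
  simp only [productKernel, Matrix.sum_apply, Matrix.smul_apply, smul_eq_mul, tensorMatrix_update]

theorem tensorMatrix_isStochastic [∀ i, Fintype (X i)] {M : ∀ i, Matrix (X i) (X i) ℝ}
    (h : ∀ i, IsStochastic (M i)) : IsStochastic (tensorMatrix M) := by
  refine ⟨fun x y => Finset.prod_nonneg fun i _ => (h i).1 _ _, fun x => ?_⟩
  have := Finset.prod_univ_sum (fun i => (Finset.univ : Finset (X i))) fun i y => M i (x i) y
  rw [Fintype.piFinset_univ] at this
  simp only [tensorMatrix]
  rw [← this]
  exact Finset.prod_eq_one fun i _ => (h i).2 _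

theorem productKernel_isStochastic [∀ i, Fintype (X i)] [∀ i, DecidableEq (X i)] {w : ι → ℝ}
    {K : ∀ i, Matrix (X i) (X i) ℝ} (hw : ∀ i, 0 ≤ w i) (hw1 : ∑ i, w i = 1)
    (hK : ∀ i, IsStochastic (K i)) : IsStochastic (productKernel w K) := by
  have h : ∀ i, IsStochastic (tensorMatrix
      (Function.update (fun j => (1 : Matrix (X j) (X j) ℝ)) i (K i))) := by
    refine fun i => tensorMatrix_isStochastic fun j => ?_
    rcases eq_or_ne j i with rfl | hj
    · simpa using hK j
    · simpa [hj] using IsStochastic.one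
  rw [productKernel_eq_sum]
  refine ⟨fun x y => ?_, fun x => ?_⟩
  · simp only [Matrix.sum_apply, Matrix.smul_apply, smul_eq_mul]
    exact Finset.sum_nonneg fun i _ => mul_nonneg (hw i) ((h i).1 _ _)
  · simp only [Matrix.sum_apply, Matrix.smul_apply, smul_eq_mul]
    rw [Finset.sum_comm]
    simp_rw [← Finset.mul_sum, (h _).2, mul_one, hw1]

theorem hasDerivAt_continuousKernel {Y : Type*} [Fintype Y] [DecidableEq Y] (K : Matrix Y Y ℝ)
    (t : ℝ) : HasDerivAt (continuousKernel K) ((K - 1) * continuousKernel K t) t := by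
  let _ : NormedRing (Matrix Y Y ℝ) := Matrix.linftyOpNormedRing
  let _ : NormedAlgebra ℝ (Matrix Y Y ℝ) := Matrix.linftyOpNormedAlgebra
  have h := hasDerivAt_exp_smul_const' (𝕂 := ℝ) (K - 1) t
  have h2 : ∀ u : ℝ, u • (K - 1) = (-u) • (1 - K) := fun u => by
    rw [neg_smul, ← smul_neg, neg_sub]
  simp only [h2] at h
  exact h

/-- In continuous time the coordinates of a product chain evolve independently. -/
theorem continuousKernel_productKernel [∀ i, Fintype (X i)] [∀ i, DecidableEq (X i)] {w : ι → ℝ}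
    (hw1 : ∑ i, w i = 1) (K : ∀ i, Matrix (X i) (X i) ℝ) (t : ℝ) :
    continuousKernel (productKernel w K) t =
      tensorMatrix fun i => continuousKernel (K i) (w i * t) := by
  set P := productKernel w K with hP
  set E : ℝ → Matrix (∀ i, X i) (∀ i, X i) ℝ := fun u =>
    tensorMatrix fun i => continuousKernel (K i) (w i * u) with hE
  let _ : NormedRing (Matrix (∀ i, X i) (∀ i, X i) ℝ) := Matrix.linftyOpNormedRing
  let _ : NormedAlgebra ℝ (Matrix (∀ i, X i) (∀ i, X i) ℝ) := Matrix.linftyOpNormedAlgebra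
  -- Both sides solve `M' = (P - 1) M` with `M 0 = 1`. The derivative of the tensor product comes
  -- from the product rule, and `∑ w i = 1` distributes the term `-E u` over the coordinates.
  have hEd : ∀ u, HasDerivAt E ((P - 1) * E u) u := by
    intro u
    have h1 : ∀ x y, HasDerivAt (fun v => E v x y) (((P - 1) * E u) x y) u := by
      intro x y
      have h2 : ∀ i, HasDerivAt (fun v => continuousKernel (K i) (w i * v) (x i) (y i))
          (w i * ((K i - 1) * continuousKernel (K i) (w i * u)) (x i) (y i)) u := by
        intro i
        have h3 := hasDerivAt_pi.1 (hasDerivAt_pi.1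
          (hasDerivAt_continuousKernel (K i) (w i * u)) (x i)) (y i)
        have h4 := h3.comp u ((hasDerivAt_id u).const_mul (w i))
        rw [mul_one, mul_comm] at h4
        exact h4
      have h3 := HasDerivAt.fun_finsetProd (u := Finset.univ) fun i _ => h2 i
      convert! h3 using 1
      rw [hP, productKernel_eq_sum, sub_mul, one_mul, Finset.sum_mul, Matrix.sub_apply,
        Matrix.sum_apply]
      have h5 : ∀ i, ((w i • tensorMatrix (Function.update (fun _ => 1) i (K i))) * E u) x y =
          w i * ((K i * continuousKernel (K i) (w i * u)) (x i) (y i) *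
            ∏ j ∈ Finset.univ.erase i, continuousKernel (K j) (w j * u) (x j) (y j)) := by
        intro i
        rw [Matrix.smul_mul, hE, tensorMatrix_mul, Matrix.smul_apply, smul_eq_mul,
          ← tensorMatrix_update (fun j => continuousKernel (K j) (w j * u)) i
            (K i * continuousKernel (K i) (w i * u))]
        congr 3
        ext j
        rcases eq_or_ne j i with rfl | hj
        · simp
        · simp [hj]
      have h6 : E u x y = ∑ i, w i * (continuousKernel (K i) (w i * u) (x i) (y i) *
            ∏ j ∈ Finset.univ.erase i, continuousKernel (K j) (w j * u) (x j) (y j)) := by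
        have : ∀ i, continuousKernel (K i) (w i * u) (x i) (y i) *
            ∏ j ∈ Finset.univ.erase i, continuousKernel (K j) (w j * u) (x j) (y j) =
            E u x y := fun i => Finset.mul_prod_erase Finset.univ
            (fun j => continuousKernel (K j) (w j * u) (x j) (y j)) (Finset.mem_univ i)
        simp_rw [this, ← Finset.sum_mul, hw1, one_mul]
      rw [h6, ← Finset.sum_sub_distrib]
      refine Finset.sum_congr rfl fun i _ => ?_
      rw [h5, sub_mul, one_mul, Matrix.sub_apply, smul_eq_mul]
      ring
    exact hasDerivAt_pi.2 fun x => hasDerivAt_pi.2 fun y => h1 x y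
  -- Uniqueness for the linear equation: multiplying by the inverse flow gives a function with zero
  -- derivative.
  have hU : ∀ u, HasDerivAt (fun v => continuousKernel P (-v) * E v) 0 u := by
    intro u
    have h1 : HasDerivAt (fun v => continuousKernel P (-v))
        (-((P - 1) * continuousKernel P (-u))) u := by
      have := (hasDerivAt_continuousKernel P (-u)).scomp u (hasDerivAt_neg u)
      rw [neg_smul, one_smul] at this
      exact this
    have hc : (P - 1) * continuousKernel P (-u) = continuousKernel P (-u) * (P - 1) := by
      have h2 : Commute (P - 1) ((- -u) • (1 - P)) := by
        refine Commute.smul_right ?_ _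
        rw [← neg_sub P 1]
        exact (Commute.refl _).neg_right
      exact h2.exp_right
    have h2 := h1.mul (hEd u)
    rw [hc] at h2
    convert! h2 using 1
    noncomm_ring
  have hconst : continuousKernel P (-t) * E t = 1 := by
    have h1 := is_const_of_deriv_eq_zero (fun u => (hU u).differentiableAt)
      (fun u => (hU u).deriv) t 0
    simp only [neg_zero, continuousKernel_zero, one_mul] at h1
    rw [h1, hE]
    simp only [mul_zero, continuousKernel_zero]
    exact tensorMatrix_one
  have h2 : continuousKernel P t * continuousKernel P (-t) = 1 := by
    rw [← continuousKernel_add, add_neg_cancel, continuousKernel_zero]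
  calc continuousKernel P t = continuousKernel P t * (continuousKernel P (-t) * E t) := by
        rw [hconst, mul_one]
    _ = E t := by rw [← mul_assoc, h2, one_mul]

omit [DecidableEq ι] in
theorem productDistribution_nonneg {π : ∀ i, X i → ℝ} (h : ∀ i x, 0 ≤ π i x) (x : ∀ i, X i) :
    0 ≤ productDistribution π x :=
  Finset.prod_nonneg fun i _ => h i _

theorem sum_productDistribution [∀ i, Fintype (X i)] {π : ∀ i, X i → ℝ}
    (h : ∀ i, ∑ x, π i x = 1) : ∑ x, productDistribution π x = 1 := by
  have := Finset.prod_univ_sum (fun i => (Finset.univ : Finset (X i))) π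
  rw [Fintype.piFinset_univ] at this
  simp only [productDistribution]
  rw [← this]
  exact Finset.prod_eq_one fun i _ => h i

end productChains

/-! ### The coordinate kernel and its stationary law -/

section lacoinChain

variable {n : ℕ} {a b c : ℝ}

theorem lacoinKernel_isStochastic (hn : 1 ≤ n) (ha : 0 ≤ a) (hb : 0 ≤ b) (hab : a + b ≤ 1)
    (hc : 0 ≤ c) (hac : a + c ≤ 1) : IsStochastic (lacoinKernel n a b c) := by
  refine ⟨fun j k => ?_, fun j => ?_⟩
  · have h : ∀ (P : Prop) [Decidable P] (r : ℝ), 0 ≤ r → 0 ≤ (if P then r else 0) := by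
      intro P _ r hr
      split_ifs
      exacts [hr, le_rfl]
    unfold lacoinKernel
    have h1 : 0 ≤ 1 - a := by linarith
    have h2 : 0 ≤ 1 - a - b := by linarith
    have h3 : 0 ≤ 1 - a - c := by linarith
    repeat' apply add_nonneg
    all_goals first | exact h _ _ h1 | exact h _ _ h2 | exact h _ _ h3 | exact h _ _ ha |
      exact h _ _ hb | exact h _ _ hc
  -- Each summand of the kernel allows at most one target, so a row sum reduces to evaluating the
  -- conditions there. Only the right step from `2n` and the left step from `0` have targets out of
  -- range.
  · have h : ∀ (P : ℕ → Prop) [DecidablePred P] (r : ℝ) (v : ℕ), v < 2 * n + 1 →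
        (∀ w, P w → w = v) →
        ∑ k : Fin (2 * n + 1), (if P k.val then r else 0) = if P v then r else 0 := by
      intro P _ r v hv hP
      refine Finset.sum_eq_single (⟨v, hv⟩ : Fin (2 * n + 1)) (fun k _ hk => if_neg fun hPk => ?_)
        (fun hk => absurd (Finset.mem_univ _) hk)
      exact hk (Fin.ext (hP _ hPk))
    obtain ⟨j, hj⟩ := j
    simp only [lacoinKernel, Finset.sum_add_distrib]
    rw [h (fun k => j = 0 ∧ k = 0) a 0 (by omega) (by omega),
      h (fun k => j = n ∧ k = n + 1) b (n + 1) (by omega) (by omega),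
      h (fun k => j = n ∧ k = 2 * n) (1 - a - b) (2 * n) (by omega) (by omega),
      h (fun k => j = 2 * n ∧ k = n) c n (by omega) (by omega),
      h (fun k => j = 2 * n ∧ k = 2 * n) (1 - a - c) (2 * n) (by omega) (by omega)]
    have h1 : ∑ k : Fin (2 * n + 1), (if k.val = j + 1 ∧ j ≠ n then 1 - a else 0) =
        if j < 2 * n ∧ j ≠ n then 1 - a else 0 := by
      rcases Nat.lt_or_ge j (2 * n) with h2 | h2
      · rw [h (fun k => k = j + 1 ∧ j ≠ n) (1 - a) (j + 1) (by omega) (by omega)]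
        simp [h2]
      · rw [Finset.sum_eq_zero fun k _ => if_neg (by omega), if_neg (by omega)]
    have h2 : ∑ k : Fin (2 * n + 1), (if j = k.val + 1 then a else 0) =
        if 0 < j then a else 0 := by
      rcases Nat.eq_zero_or_pos j with h2 | h2
      · rw [Finset.sum_eq_zero fun k _ => if_neg (by omega), if_neg (by omega)]
      · rw [h (fun k => j = k + 1) a (j - 1) (by omega) (by omega), if_pos (by omega), if_pos h2]
    rw [h1, h2]
    split_ifs <;> first | omega | ring

theorem lacoinKernel_right {j : ℕ} (hj : j < 2 * n)
    (hjn : j ≠ n) :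
    1 - a ≤ lacoinKernel n a b c ⟨j, by omega⟩ ⟨j + 1, by omega⟩ := by
  simp only [lacoinKernel]
  rw [if_pos (by simp; try omega), if_neg (by omega), if_neg (by omega),
    if_neg (by omega), if_neg (by omega), if_neg (by omega), if_neg (by omega)]
  linarith

theorem lacoinKernel_mid_slow (hn : 1 ≤ n) (hab : a + b ≤ 1) :
    b ≤ lacoinKernel n a b c ⟨n, by omega⟩ ⟨n + 1, by omega⟩ := by
  have h : 0 ≤ if n = n ∧ n + 1 = 2 * n then 1 - a - b else 0 := by
    split_ifs
    exacts [by linarith, le_rfl]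
  unfold lacoinKernel
  dsimp only
  rw [if_neg (by omega), if_neg (by omega), if_neg (by omega), if_pos ⟨rfl, rfl⟩,
    if_neg (c := n = 2 * n ∧ n + 1 = n) (by omega),
    if_neg (c := n = 2 * n ∧ n + 1 = 2 * n) (by omega)]
  linarith

theorem lacoinKernel_mid_fast (hn : 1 ≤ n) (hb : 0 ≤ b) :
    1 - a - b ≤ lacoinKernel n a b c ⟨n, by omega⟩ (Fin.last (2 * n)) := by
  have h : 0 ≤ if n = n ∧ 2 * n = n + 1 then b else 0 := by
    split_ifs
    exacts [hb, le_rfl]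
  unfold lacoinKernel
  dsimp only [Fin.val_last]
  rw [if_neg (by omega), if_neg (by omega), if_neg (by omega),
    if_pos (c := n = n ∧ 2 * n = 2 * n) ⟨rfl, rfl⟩,
    if_neg (c := n = 2 * n ∧ 2 * n = n) (by omega),
    if_neg (c := n = 2 * n ∧ 2 * n = 2 * n) (by omega)]
  linarith

theorem lacoinKernel_last (hn : 1 ≤ n) :
    1 - a - c ≤ lacoinKernel n a b c (Fin.last (2 * n)) (Fin.last (2 * n)) := by
  simp only [lacoinKernel, Fin.val_last]
  rw [if_neg (by omega), if_neg (by omega), if_neg (by omega),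
    if_neg (by omega), if_neg (by omega), if_neg (by omega), if_pos (by simp; try omega)]
  linarith

theorem lacoinKernel_last_mid (hn : 2 ≤ n) :
    lacoinKernel n a b c (Fin.last (2 * n)) ⟨n, by omega⟩ = c := by
  simp only [lacoinKernel, Fin.val_last]
  rw [if_neg (by omega), if_neg (by omega), if_neg (by omega),
    if_neg (by omega), if_neg (by omega), if_pos (by simp; try omega), if_neg (by omega)]
  ring

theorem lacoinKernel_left (hn : 2 ≤ n) {j : ℕ} (hj : j < 2 * n) :
    lacoinKernel n a b c ⟨j + 1, by omega⟩ ⟨j, by omega⟩ = a := by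
  simp only [lacoinKernel]
  rw [if_neg (by omega), if_neg (by omega), if_pos (by simp; try omega),
    if_neg (by omega), if_neg (by omega), if_neg (by omega), if_neg (by omega)]
  ring

theorem lacoinKernel_eq_zero {j k : Fin (2 * n + 1)} (hj : j.val < n) (hk : j.val + 1 < k.val) :
    lacoinKernel n a b c j k = 0 := by
  simp only [lacoinKernel]
  rw [if_neg (by omega), if_neg (by omega), if_neg (by omega), if_neg (by omega),
    if_neg (by omega), if_neg (by omega), if_neg (by omega)]
  norm_num

variable {π : Fin (2 * n + 1) → ℝ}

/-- Detailed balance across the edge from `j` to `j + 1`: the way back has probability `a`, the way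
forth at least `a`. At `j = n` this is where `a < b` enters. -/
theorem lacoin_stationary_le_succ (hn : 2 ≤ n) (ha : 0 < a) (hab : a < b) (hab' : a + b < 1 / 2)
    (hπ : ∀ x, 0 ≤ π x) (hrev : IsReversibleChain (lacoinKernel n a b c) π) {j : ℕ}
    (hj : j < 2 * n) : π ⟨j, by omega⟩ ≤ π ⟨j + 1, by omega⟩ := by
  have h1 := hrev ⟨j, by omega⟩ ⟨j + 1, by omega⟩
  rw [lacoinKernel_left hn hj] at h1
  have h2 : a ≤ lacoinKernel n a b c ⟨j, by omega⟩ ⟨j + 1, by omega⟩ := by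
    rcases eq_or_ne j n with rfl | hjn
    · exact hab.le.trans (lacoinKernel_mid_slow (by omega) (by linarith))
    · refine le_trans ?_ (lacoinKernel_right hj hjn)
      linarith
  refine le_of_mul_le_mul_right (a := a) ?_ ha
  rw [← h1]
  exact mul_le_mul_of_nonneg_left h2 (hπ _)

theorem lacoin_stationary_mono (hn : 2 ≤ n) (ha : 0 < a) (hab : a < b) (hab' : a + b < 1 / 2)
    (hπ : ∀ x, 0 ≤ π x) (hrev : IsReversibleChain (lacoinKernel n a b c) π) {j k : ℕ}
    (hjk : j ≤ k) (hk : k < 2 * n + 1) : π ⟨j, by omega⟩ ≤ π ⟨k, hk⟩ := by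
  induction k, hjk using Nat.le_induction with
  | base => exact le_rfl
  | succ k hk' ih =>
    exact (ih (by omega)).trans
      (lacoin_stationary_le_succ hn ha hab hab' hπ hrev (by omega))

theorem lacoin_stationary_last_pos (hn : 2 ≤ n) (ha : 0 < a) (hab : a < b) (hab' : a + b < 1 / 2)
    (hπ : ∀ x, 0 ≤ π x) (hπ1 : ∑ x, π x = 1)
    (hrev : IsReversibleChain (lacoinKernel n a b c) π) : 0 < π (Fin.last (2 * n)) := by
  by_contra! h
  have h1 : ∑ x, π x ≤ 0 := Finset.sum_nonpos fun x _ =>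
    (lacoin_stationary_mono hn ha hab hab' hπ hrev (Nat.le_of_lt_succ x.isLt) (by omega)).trans h
  linarith

/-- Reversibility forces the jump probability from `2n` to `n` to be small. -/
theorem lacoin_jump_le (hn : 2 ≤ n) (ha : 0 < a) (hab : a < b) (hab' : a + b < 1 / 2)
    (hc : 0 ≤ c) (hac : a + c ≤ 1) (hπ : ∀ x, 0 ≤ π x) (hπ1 : ∑ x, π x = 1)
    (hrev : IsReversibleChain (lacoinKernel n a b c) π) : c ≤ 2 * a := by
  have hK := lacoinKernel_isStochastic (n := n) (a := a) (b := b) (c := c) (by omega) ha.le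
    (by linarith) (by linarith) hc hac
  have hpos := lacoin_stationary_last_pos hn ha hab hab' hπ hπ1 hrev
  have h1 := hrev (Fin.last (2 * n)) ⟨n, by omega⟩
  rw [lacoinKernel_last_mid hn] at h1
  -- Detailed balance gives `π(2n) c ≤ π(n) ≤ π(2n - 1)`, and across the last edge `(1 - a) π(2n -
  -- 1) ≤ a π(2n)`, where `1 - a ≥ 1/2`. For `n ≥ 2` the state `2n - 1` is not `n`, so its right
  -- step does have probability `1 - a`.
  have h2 : π (Fin.last (2 * n)) * c ≤ π ⟨n, by omega⟩ :=
    h1 ▸ mul_le_of_le_one_right (hπ _) (hK.le_one _ _)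
  have h3 : π ⟨n, by omega⟩ ≤ π ⟨2 * n - 1, by omega⟩ :=
    lacoin_stationary_mono hn ha hab hab' hπ hrev (by omega) (by omega)
  have h4 := hrev ⟨2 * n - 1, by omega⟩ ⟨2 * n - 1 + 1, by omega⟩
  have h5 : (⟨2 * n - 1 + 1, by omega⟩ : Fin (2 * n + 1)) = Fin.last (2 * n) :=
    Fin.ext (by simp only [Fin.val_last]; omega)
  rw [lacoinKernel_left hn (by omega)] at h4
  have h6 : 1 - a ≤ lacoinKernel n a b c ⟨2 * n - 1, by omega⟩ ⟨2 * n - 1 + 1, by omega⟩ :=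
    lacoinKernel_right (by omega) (by omega)
  have h7 := mul_le_mul_of_nonneg_left h6 (hπ ⟨2 * n - 1, by omega⟩)
  rw [h4, h5] at h7
  have h8 : π ⟨2 * n - 1, by omega⟩ * (1 / 2) ≤ π ⟨2 * n - 1, by omega⟩ * (1 - a) :=
    mul_le_mul_of_nonneg_left (by linarith) (hπ _)
  refine le_of_mul_le_mul_left (a := π (Fin.last (2 * n))) ?_ hpos
  linarith

end lacoinChain

/-! ### Arrival at `2n` after a given number of steps -/

section lacoinSteps

variable {n : ℕ} {a b c : ℝ} (hn : 2 ≤ n) (ha : 0 < a) (hb : 0 < b) (hab' : a + b < 1 / 2)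
  (hc : 0 ≤ c) (hac : a + c ≤ 1)

theorem le_pow_succ {X : Type*} [Fintype X] [DecidableEq X] {K : Matrix X X ℝ}
    (hK : IsStochastic K) (m : ℕ) (x y z : X) : K x y * (K ^ m) y z ≤ (K ^ (m + 1)) x z := by
  rw [pow_succ', Matrix.mul_apply]
  exact Finset.single_le_sum (f := fun w => K x w * (K ^ m) w z)
    (fun w _ => mul_nonneg (hK.1 _ _) ((hK.pow m).1 _ _)) (Finset.mem_univ y)

theorem le_one_sub_pow_succ {X : Type*} [Fintype X] [DecidableEq X] {K : Matrix X X ℝ}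
    (hK : IsStochastic K) (m : ℕ) (x y z : X) :
    K x y * (1 - (K ^ m) y z) ≤ 1 - (K ^ (m + 1)) x z := by
  have h : 1 - (K ^ (m + 1)) x z = ∑ w, K x w * (1 - (K ^ m) w z) := by
    simp_rw [mul_one_sub, Finset.sum_sub_distrib, hK.2, pow_succ', Matrix.mul_apply]
  rw [h]
  exact Finset.single_le_sum (f := fun w => K x w * (1 - (K ^ m) w z))
    (fun w _ => mul_nonneg (hK.1 _ _) (sub_nonneg.2 ((hK.pow m).le_one _ _))) (Finset.mem_univ y)

include hn ha hb hab' hc hac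

/-- Count only paths that never move left, and hold at `2n` once there: each step has probability at
least `1 - a - c`, and `m ≥ 2n - j` steps suffice on either route. -/
theorem lacoin_pow_last_ge (m : ℕ) {j : ℕ} (hj : j < 2 * n + 1) (hm : 2 * n ≤ m + j) :
    (1 - a - c) ^ m ≤ (lacoinKernel n a b c ^ m) ⟨j, hj⟩ (Fin.last (2 * n)) := by
  have hK := lacoinKernel_isStochastic (n := n) (a := a) (b := b) (c := c) (by omega) ha.le
    hb.le (by linarith) hc hac
  have hρ : 0 ≤ 1 - a - c := by linarith
  have hρ' : 1 - a - c ≤ 1 - a := by linarith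
  induction m generalizing j with
  | zero =>
    have : (⟨j, hj⟩ : Fin (2 * n + 1)) = Fin.last (2 * n) :=
      Fin.ext (by simp only [Fin.val_last]; omega)
    rw [this]; simp
  | succ m ih =>
    rw [pow_succ' (1 - a - c)]
    have hpow : 0 ≤ (1 - a - c) ^ m := pow_nonneg hρ m
    rcases Nat.lt_or_ge j (2 * n) with h1 | h1
    · rcases eq_or_ne j n with rfl | hjn
      · have h2 := ih (j := j + 1) (by omega) (by omega)
        have h3 := ih (j := 2 * j) (by omega) (by omega)
        rw [show (⟨2 * j, by omega⟩ : Fin (2 * j + 1)) = Fin.last (2 * j) from rfl] at h3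
        have hne : (⟨j + 1, by omega⟩ : Fin (2 * j + 1)) ≠ Fin.last (2 * j) := fun h => by
          have := congrArg Fin.val h
          simp only [Fin.val_last] at this
          omega
        rw [pow_succ', Matrix.mul_apply]
        -- At the state `n` both routes are kept: their probabilities `b` and `1 - a - b` add up to
        -- `1 - a`. They have different targets because `n ≥ 2`.
        refine le_trans ?_ (Finset.add_le_sum (f := fun w =>
          lacoinKernel j a b c ⟨j, hj⟩ w * (lacoinKernel j a b c ^ m) w (Fin.last (2 * j)))
          (fun w _ => mul_nonneg (hK.1 _ _) ((hK.pow m).1 _ _)) (Finset.mem_univ _)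
          (Finset.mem_univ _) hne)
        have h4 := mul_le_mul (lacoinKernel_mid_slow (n := j) (a := a) (b := b) (c := c)
          (by omega) (by linarith)) h2 hpow (hK.1 _ _)
        have h5 := mul_le_mul (lacoinKernel_mid_fast (n := j) (a := a) (b := b) (c := c)
          (by omega) hb.le) h3 hpow (hK.1 _ _)
        refine le_trans ?_ (add_le_add h4 h5)
        nlinarith
      · refine le_trans ?_ (le_pow_succ hK m _ ⟨j + 1, by omega⟩ _)
        exact mul_le_mul (hρ'.trans (lacoinKernel_right h1 hjn))
          (ih _ (by omega)) hpow (hK.1 _ _)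
    · have : (⟨j, hj⟩ : Fin (2 * n + 1)) = Fin.last (2 * n) :=
        Fin.ext (by simp only [Fin.val_last]; omega)
      rw [this]
      refine le_trans ?_ (le_pow_succ hK m _ (Fin.last (2 * n)) _)
      exact mul_le_mul (lacoinKernel_last (by omega))
        (ih (j := 2 * n) (by omega) (by omega)) hpow (hK.1 _ _)

theorem lacoin_pow_last_ge_of_fast (m : ℕ) {j : ℕ} (hj : j ≤ n) (hm : n + 1 ≤ m + j) :
    (1 - a - b) * (1 - a - c) ^ m ≤
      (lacoinKernel n a b c ^ m) ⟨j, by omega⟩ (Fin.last (2 * n)) := by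
  have hK := lacoinKernel_isStochastic (n := n) (a := a) (b := b) (c := c) (by omega) ha.le
    hb.le (by linarith) hc hac
  have hρ : 0 ≤ 1 - a - c := by linarith
  have hρ' : 1 - a - c ≤ 1 - a := by linarith
  induction m generalizing j with
  | zero => omega
  | succ m ih =>
    have hpow : 0 ≤ (1 - a - c) ^ m := pow_nonneg hρ m
    rcases hj.eq_or_lt with rfl | hjn
    · refine le_trans ?_ (le_pow_succ hK m _ (Fin.last (2 * j)) _)
      have h3 := lacoin_pow_last_ge hn ha hb hab' hc hac m (j := 2 * j) (by omega) (by omega)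
      refine mul_le_mul (lacoinKernel_mid_fast (by omega) hb.le) (le_trans ?_ h3)
        (pow_nonneg hρ _) (hK.1 _ _)
      rw [pow_succ]
      exact mul_le_of_le_one_right hpow (by linarith)
    · refine le_trans ?_ (le_pow_succ hK m _ ⟨j + 1, by omega⟩ _)
      rw [pow_succ', mul_left_comm]
      exact mul_le_mul (hρ'.trans (lacoinKernel_right
        (by omega) hjn.ne)) (ih hjn (by omega)) (mul_nonneg (by linarith) hpow) (hK.1 _ _)

theorem lacoin_one_sub_pow_ge (m : ℕ) {j : ℕ} (hj : n < j) (hm : j + m < 2 * n) :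
    (1 - a) ^ m ≤ 1 - (lacoinKernel n a b c ^ m) ⟨j, by omega⟩ (Fin.last (2 * n)) := by
  have hK := lacoinKernel_isStochastic (n := n) (a := a) (b := b) (c := c) (by omega) ha.le
    hb.le (by linarith) hc hac
  induction m generalizing j with
  | zero =>
    have : (⟨j, by omega⟩ : Fin (2 * n + 1)) ≠ Fin.last (2 * n) := fun h => by
      have := congrArg Fin.val h
      simp only [Fin.val_last] at this
      omega
    simp [Matrix.one_apply_ne this]
  | succ m ih =>
    refine le_trans ?_ (le_one_sub_pow_succ hK m _ ⟨j + 1, by omega⟩ _)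
    rw [pow_succ']
    exact mul_le_mul (lacoinKernel_right (by omega) hj.ne')
      (ih (by omega) (by omega)) (pow_nonneg (by linarith) _) (hK.1 _ _)

/-- The path that keeps stepping to the right by one pays the factor `b` once, at `n`, and `j + m <
2n` leaves it short of `2n`. -/
theorem lacoin_one_sub_pow_ge_of_slow (m : ℕ) {j : ℕ} (hj : j ≤ n) (hm : j + m < 2 * n) :
    b * (1 - a) ^ m ≤ 1 - (lacoinKernel n a b c ^ m) ⟨j, by omega⟩ (Fin.last (2 * n)) := by
  have hK := lacoinKernel_isStochastic (n := n) (a := a) (b := b) (c := c) (by omega) ha.le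
    hb.le (by linarith) hc hac
  have ha' : 0 ≤ 1 - a := by linarith
  induction m generalizing j with
  | zero =>
    have : (⟨j, by omega⟩ : Fin (2 * n + 1)) ≠ Fin.last (2 * n) := fun h => by
      have := congrArg Fin.val h
      simp only [Fin.val_last] at this
      omega
    rw [pow_zero, pow_zero, Matrix.one_apply_ne this]
    linarith
  | succ m ih =>
    refine le_trans ?_ (le_one_sub_pow_succ hK m _ ⟨j + 1, by omega⟩ _)
    rcases hj.eq_or_lt with rfl | hjn
    · refine mul_le_mul (lacoinKernel_mid_slow (by omega) (by linarith)) (le_trans ?_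
        (lacoin_one_sub_pow_ge hn ha hb hab' hc hac m (by omega) (by omega)))
        (pow_nonneg ha' _) (hK.1 _ _)
      rw [pow_succ]
      exact mul_le_of_le_one_right (pow_nonneg ha' _) (by linarith)
    · rw [pow_succ', mul_left_comm]
      exact mul_le_mul (lacoinKernel_right (by omega) hjn.ne)
        (ih hjn (by omega)) (mul_nonneg hb.le (pow_nonneg ha' _)) (hK.1 _ _)

-- Left of `n` a step gains at most one, so the jump to `2n` cannot have been made yet.
omit ha hb hab' hc hac in
theorem lacoin_pow_eq_zero (m : ℕ) {j : ℕ} (hm : j + m ≤ n) :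
    (lacoinKernel n a b c ^ m) ⟨j, by omega⟩ (Fin.last (2 * n)) = 0 := by
  induction m generalizing j with
  | zero =>
    have : (⟨j, by omega⟩ : Fin (2 * n + 1)) ≠ Fin.last (2 * n) := fun h => by
      have := congrArg Fin.val h
      simp only [Fin.val_last] at this
      omega
    simp [Matrix.one_apply_ne this]
  | succ m ih =>
    rw [pow_succ', Matrix.mul_apply]
    refine Finset.sum_eq_zero fun k _ => ?_
    rcases Nat.lt_or_ge (j + 1) k.val with hk | hk
    · rw [lacoinKernel_eq_zero (by simp only; omega) hk, zero_mul]
    · have := ih (j := k.val) (by omega)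
      rw [show k = ⟨k.val, by omega⟩ from rfl, this, mul_zero]

/-- After the time of the slow route the chain has reached `2n` with high probability. -/
theorem lacoin_slow_arrival {θ t : ℝ} (hθ : 0 ≤ θ) (ht : 0 ≤ t) (x : Fin (2 * n + 1)) :
    Real.exp (-(t * (a + c))) - Real.exp (2 * n * θ - t * (1 - Real.exp (-θ))) ≤
      continuousKernel (lacoinKernel n a b c) t x (Fin.last (2 * n)) := by
  have hK := lacoinKernel_isStochastic (n := n) (a := a) (b := b) (c := c) (by omega) ha.le
    hb.le (by linarith) hc hac
  have := le_continuousKernel_of_steps hK (N := 2 * n) (α := 1) (ρ := 1 - a - c) ht hθ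
    zero_le_one (by linarith) (by linarith) (x := x) (y := Fin.last (2 * n)) fun m hm => by
      rw [one_mul]
      exact lacoin_pow_last_ge hn ha hb hab' hc hac m x.isLt (by omega)
  rw [one_mul, show 1 - (1 - a - c) = a + c by ring] at this
  exact_mod_cast this

/-- After the time of the fast route the chain has reached `2n` unless it took the slow route. -/
theorem lacoin_fast_arrival {θ t : ℝ} (hθ : 0 ≤ θ) (ht : 0 ≤ t) (x : Fin (2 * n + 1)) :
    (1 - a - b) *
      (Real.exp (-(t * (a + c))) - Real.exp ((n + 1) * θ - t * (1 - Real.exp (-θ)))) ≤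
      continuousKernel (lacoinKernel n a b c) t x (Fin.last (2 * n)) := by
  have hK := lacoinKernel_isStochastic (n := n) (a := a) (b := b) (c := c) (by omega) ha.le
    hb.le (by linarith) hc hac
  have := le_continuousKernel_of_steps hK (N := n + 1) (α := 1 - a - b) (ρ := 1 - a - c) ht hθ
    (by linarith) (by linarith) (by linarith) (x := x) (y := Fin.last (2 * n)) fun m hm => by
      rcases Nat.lt_or_ge n x.val with hx | hx
      · refine le_trans ?_ (lacoin_pow_last_ge hn ha hb hab' hc hac m x.isLt (by omega))
        exact mul_le_of_le_one_left (pow_nonneg (by linarith) _) (by linarith)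
      · exact lacoin_pow_last_ge_of_fast hn ha hb hab' hc hac m hx (by omega)
  rw [show 1 - (1 - a - c) = a + c by ring] at this
  exact_mod_cast this

/-- Before the time of the slow route the chain started at `0` is still travelling if it took
the slow route. -/
theorem lacoin_slow_travel {θ t : ℝ} (hθ : 0 ≤ θ) (ht : 0 ≤ t) :
    b * (Real.exp (-(t * a)) - Real.exp (t * (Real.exp θ - 1) - 2 * n * θ)) ≤
      1 - continuousKernel (lacoinKernel n a b c) t 0 (Fin.last (2 * n)) := by
  have hK := lacoinKernel_isStochastic (n := n) (a := a) (b := b) (c := c) (by omega) ha.le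
    hb.le (by linarith) hc hac
  have := le_one_sub_continuousKernel_of_steps hK (N := 2 * n) (α := b) (ρ := 1 - a) ht hθ
    hb.le (by linarith) (by linarith) (x := 0) (y := Fin.last (2 * n)) fun m hm =>
      lacoin_one_sub_pow_ge_of_slow hn ha hb hab' hc hac m (j := 0) (by omega) (by omega)
  rw [show 1 - (1 - a) = a by ring] at this
  exact_mod_cast this

/-- Before the time of the fast route the chain started at `0` is still travelling. -/
theorem lacoin_fast_travel {θ t : ℝ} (hθ : 0 ≤ θ) (ht : 0 ≤ t) :
    continuousKernel (lacoinKernel n a b c) t 0 (Fin.last (2 * n)) ≤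
      Real.exp (t * (Real.exp θ - 1) - n * θ) := by
  have hK := lacoinKernel_isStochastic (n := n) (a := a) (b := b) (c := c) (by omega) ha.le
    hb.le (by linarith) hc hac
  have := le_one_sub_continuousKernel_of_steps hK (N := n) (α := 1) (ρ := 1) ht hθ
    zero_le_one zero_le_one le_rfl (x := 0) (y := Fin.last (2 * n)) fun m hm => by
      rw [show (0 : Fin (2 * n + 1)) = ⟨0, by omega⟩ from rfl,
        lacoin_pow_eq_zero hn m (by omega)]
      simp
  rw [sub_self, mul_zero, neg_zero, Real.exp_zero, one_mul] at this
  linarith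

end lacoinSteps

/-! ### Estimates uniform over the coordinate chains -/

/-- To first order in `θ` the claim is `u < v`. The witness makes `u (1 + θ)` the midpoint of `u`
and `v`, and `1 - exp (-θ) ≥ θ / (1 + θ)`. This yields a positive Chernoff rate. -/
theorem exists_mul_lt_mul_one_sub_exp_neg {u v : ℝ} (hu : 0 < u) (huv : u < v) :
    ∃ θ > 0, u * θ < v * (1 - Real.exp (-θ)) := by
  refine ⟨(v - u) / (2 * u), div_pos (by linarith) (by linarith), ?_⟩
  set θ := (v - u) / (2 * u) with hθ
  have hθ0 : 0 < θ := div_pos (by linarith) (by linarith)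
  have h1 : u * (1 + θ) < v := by
    have : u * θ = (v - u) / 2 := by rw [hθ]; field_simp
    linarith
  have h2 : Real.exp (-θ) ≤ 1 / (1 + θ) := by
    rw [Real.exp_neg, ← one_div]
    exact one_div_le_one_div_of_le (by linarith) (by linarith [Real.add_one_le_exp θ])
  have h3 : θ / (1 + θ) ≤ 1 - Real.exp (-θ) := by
    have : θ / (1 + θ) = 1 - 1 / (1 + θ) := by field_simp; ring
    linarith
  calc u * θ = u * (1 + θ) * (θ / (1 + θ)) := by field_simp
    _ < v * (θ / (1 + θ)) := mul_lt_mul_of_pos_right h1 (by positivity)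
    _ ≤ v * (1 - Real.exp (-θ)) := mul_le_mul_of_nonneg_left h3 (by linarith)

theorem exists_mul_exp_sub_one_lt_mul {u v : ℝ} (hu : 0 < u) (huv : u < v) :
    ∃ θ > 0, u * (Real.exp θ - 1) < v * θ := by
  refine ⟨(v - u) / (2 * v), div_pos (by linarith) (by linarith), ?_⟩
  set θ := (v - u) / (2 * v) with hθ
  have hv : 0 < v := by linarith
  have hθ0 : 0 < θ := div_pos (by linarith) (by linarith)
  have h0 : v * θ = (v - u) / 2 := by rw [hθ]; field_simp
  have h1 : u < v * (1 - θ) := by linarith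
  have h4 : 0 < 1 - θ := by
    by_contra! h
    nlinarith
  have h2 : Real.exp θ ≤ 1 / (1 - θ) := by
    rw [le_div_iff₀ h4]
    have h5 := mul_le_mul_of_nonneg_left (Real.one_sub_le_exp_neg θ) (Real.exp_pos θ).le
    rwa [← Real.exp_add, add_neg_cancel, Real.exp_zero] at h5
  have h3 : Real.exp θ - 1 ≤ θ / (1 - θ) := by
    have : θ / (1 - θ) = 1 / (1 - θ) - 1 := by field_simp; ring
    linarith
  calc u * (Real.exp θ - 1) ≤ u * (θ / (1 - θ)) := mul_le_mul_of_nonneg_left h3 hu.le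
    _ < v * (1 - θ) * (θ / (1 - θ)) := mul_lt_mul_of_pos_right h1 (by positivity)
    _ = v * θ := by field_simp

/-- The standing assumptions on a coordinate chain. -/
structure IsLacoinChain (n : ℕ) (a b c : ℝ) (π : Fin (2 * n + 1) → ℝ) : Prop where
  pos_a : 0 < a
  a_lt_b : a < b
  add_lt : a + b < 1 / 2
  nonneg_c : 0 ≤ c
  add_le : a + c ≤ 1
  stationary : IsStationaryDistribution (lacoinKernel n a b c) π
  reversible : IsReversibleChain (lacoinKernel n a b c) π

namespace IsLacoinChain

variable {n : ℕ} {a b c : ℝ} {π : Fin (2 * n + 1) → ℝ}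

theorem pos_b (h : IsLacoinChain n a b c π) : 0 < b := h.pos_a.trans h.a_lt_b

theorem isStochastic (h : IsLacoinChain n a b c π) (hn : 1 ≤ n) :
    IsStochastic (lacoinKernel n a b c) :=
  lacoinKernel_isStochastic hn h.pos_a.le h.pos_b.le (by linarith [h.add_lt]) h.nonneg_c h.add_le

theorem c_le (h : IsLacoinChain n a b c π) (hn : 2 ≤ n) : c ≤ 2 * a :=
  lacoin_jump_le hn h.pos_a h.a_lt_b h.add_lt h.nonneg_c h.add_le h.stationary.1 h.stationary.2.1
    h.reversible

theorem last_le_one (h : IsLacoinChain n a b c π) : π (Fin.last (2 * n)) ≤ 1 :=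
  h.stationary.2.1 ▸ Finset.single_le_sum (fun x _ => h.stationary.1 x) (Finset.mem_univ _)

/-- A coordinate with large `p_i / p̂_n` runs for very long, and the bounds by non-returning paths
degrade with time. Once at `2n`, however, reversibility keeps the return probability at least its
stationary value at all later times. -/
theorem mul_last_le (h : IsLacoinChain n a b c π) (hn : 2 ≤ n) {s t : ℝ} (hs : 0 ≤ s)
    (hst : s ≤ t) (x : Fin (2 * n + 1)) :
    continuousKernel (lacoinKernel n a b c) s x (Fin.last (2 * n)) * π (Fin.last (2 * n)) ≤
      continuousKernel (lacoinKernel n a b c) t x (Fin.last (2 * n)) := by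
  have hK := h.isStochastic (by omega)
  have h1 := mul_le_continuousKernel_add hK x (Fin.last (2 * n)) hs (sub_nonneg.2 hst)
  rw [add_sub_cancel] at h1
  refine le_trans (mul_le_mul_of_nonneg_left ?_ ((hK.continuousKernel hs).1 _ _)) h1
  exact le_continuousKernel_self hK h.reversible h.stationary.1 h.stationary.2.1
    (lacoin_stationary_last_pos hn h.pos_a h.a_lt_b h.add_lt h.stationary.1 h.stationary.2.1
      h.reversible) (sub_nonneg.2 hst)

end IsLacoinChain

theorem lacoin_slow_arrival_at {u : ℝ} (hu : 2 < u) : ∃ κ > 0, ∀ (n : ℕ) (a b c : ℝ)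
    (π : Fin (2 * n + 1) → ℝ), 2 ≤ n → IsLacoinChain n a b c π → ∀ x,
    1 - 3 * u * (n * a) - Real.exp (-(κ * n)) ≤
      continuousKernel (lacoinKernel n a b c) (u * n) x (Fin.last (2 * n)) := by
  obtain ⟨θ, hθ, h1⟩ := exists_mul_lt_mul_one_sub_exp_neg two_pos hu
  refine ⟨u * (1 - Real.exp (-θ)) - 2 * θ, sub_pos.2 h1, fun n a b c π hn h x => ?_⟩
  have hn0 : (0 : ℝ) ≤ n := Nat.cast_nonneg n
  have hun : 0 ≤ u * n := mul_nonneg (by linarith) hn0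
  refine le_trans ?_ (lacoin_slow_arrival hn h.pos_a h.pos_b h.add_lt h.nonneg_c h.add_le hθ.le
    hun x)
  have h2 := Real.one_sub_le_exp_neg (u * n * (a + c))
  have h3 : u * n * (a + c) ≤ 3 * u * (n * a) := by
    have := mul_le_mul_of_nonneg_left (h.c_le hn) hun
    linarith
  rw [show -((u * (1 - Real.exp (-θ)) - 2 * θ) * n) =
    2 * n * θ - u * n * (1 - Real.exp (-θ)) by ring]
  linarith

theorem lacoin_stationary_last_ge : ∃ κ > 0, ∀ (n : ℕ) (a b c : ℝ)
    (π : Fin (2 * n + 1) → ℝ), 2 ≤ n → IsLacoinChain n a b c π →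
    1 - 9 * (n * a) - Real.exp (-(κ * n)) ≤ π (Fin.last (2 * n)) := by
  -- Any `u > 2` would do; `u = 3` gives the constant `9 = 3 * 3`.
  obtain ⟨κ, hκ, h1⟩ := lacoin_slow_arrival_at (u := 3) (by norm_num)
  refine ⟨κ, hκ, fun n a b c π hn h => h.stationary.le_of_forall (t := 3 * n) fun x => ?_⟩
  have := h1 n a b c π hn h x
  linarith

theorem exp_neg_mul_le {κ κ' : ℝ} (h : κ ≤ κ') (n : ℕ) :
    Real.exp (-(κ' * n)) ≤ Real.exp (-(κ * n)) :=
  Real.exp_le_exp.2 (neg_le_neg (mul_le_mul_of_nonneg_right h (Nat.cast_nonneg n)))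

theorem lacoin_slow_arrival_after {u : ℝ} (hu : 2 < u) : ∃ C > 0, ∃ κ > 0, ∀ (n : ℕ) (a b c : ℝ)
    (π : Fin (2 * n + 1) → ℝ), 2 ≤ n → IsLacoinChain n a b c π → ∀ x t, u * n ≤ t →
    1 - C * (n * a + Real.exp (-(κ * n))) ≤
      continuousKernel (lacoinKernel n a b c) t x (Fin.last (2 * n)) := by
  obtain ⟨κ₁, hκ₁, h1⟩ := lacoin_slow_arrival_at hu
  obtain ⟨κ₂, hκ₂, h2⟩ := lacoin_stationary_last_ge
  refine ⟨3 * u + 9, by linarith, min κ₁ κ₂, lt_min hκ₁ hκ₂, fun n a b c π hn h x t ht => ?_⟩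
  have hun : 0 ≤ u * n := mul_nonneg (by linarith) (Nat.cast_nonneg n)
  refine le_trans ?_ (h.mul_last_le hn hun ht x)
  have h3 := h1 n a b c π hn h x
  have h4 := h2 n a b c π hn h
  have h5 := ((h.isStochastic (by omega)).continuousKernel hun).le_one x (Fin.last (2 * n))
  have h6 := h.last_le_one
  have h7 := mul_nonneg (sub_nonneg.2 h5) (sub_nonneg.2 h6)
  have h8 := exp_neg_mul_le (min_le_left κ₁ κ₂) n
  have h9 := exp_neg_mul_le (min_le_right κ₁ κ₂) n
  have h10 : 0 < Real.exp (-(min κ₁ κ₂ * n)) := Real.exp_pos _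
  nlinarith

/-- The factor `1 - b` is kept apart from the error: over the coordinates the `b`'s may have a large
sum and must end up in an exponential, while the errors are summable to something small. -/
theorem lacoin_fast_arrival_after {u : ℝ} (hu : 1 < u) : ∃ C > 0, ∃ κ > 0, ∀ (n : ℕ) (a b c : ℝ)
    (π : Fin (2 * n + 1) → ℝ), 2 ≤ n → IsLacoinChain n a b c π → ∀ x t, u * n ≤ t →
    (1 - b) * (1 - C * (n * a + Real.exp (-(κ * n)))) ≤
      continuousKernel (lacoinKernel n a b c) t x (Fin.last (2 * n)) := by
  obtain ⟨θ, hθ, h1⟩ := exists_mul_lt_mul_one_sub_exp_neg one_pos hu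
  rw [one_mul] at h1
  set κ₁ := u * (1 - Real.exp (-θ)) - θ with hκ₁
  obtain ⟨κ₂, hκ₂, h2⟩ := lacoin_stationary_last_ge
  -- The coefficient of `n * a` collects `3u` from `a + c ≤ 3a`, `2` from replacing `1 - a - b` by
  -- `1 - b`, and `18` from twice the stationary defect. The summand `exp θ` stems from the extra
  -- step in `N = n + 1`.
  refine ⟨3 * u + 20 + Real.exp θ, by positivity, min κ₁ κ₂, lt_min (sub_pos.2 h1) hκ₂,
    fun n a b c π hn h x t ht => ?_⟩
  have hn0 : (0 : ℝ) ≤ n := Nat.cast_nonneg n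
  have hun : 0 ≤ u * n := mul_nonneg (by linarith) hn0
  refine le_trans ?_ (h.mul_last_le hn hun ht x)
  have h3 := lacoin_fast_arrival hn h.pos_a h.pos_b h.add_lt h.nonneg_c h.add_le hθ.le hun x
  have h4 := h2 n a b c π hn h
  have h5 := ((h.isStochastic (by omega)).continuousKernel hun).le_one x (Fin.last (2 * n))
  have h6 := h.last_le_one
  have h8 := exp_neg_mul_le (min_le_left κ₁ κ₂) n
  have h9 := exp_neg_mul_le (min_le_right κ₁ κ₂) n
  set H := continuousKernel (lacoinKernel n a b c) (u * n) x (Fin.last (2 * n)) with hH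
  set P := π (Fin.last (2 * n)) with hP
  set E := Real.exp (-(min κ₁ κ₂ * n)) with hE
  have hEpos : 0 < E := Real.exp_pos _
  have ha := h.pos_a
  have hb := h.pos_b
  have hab := h.add_lt
  have h10 : Real.exp ((n + 1) * θ - u * n * (1 - Real.exp (-θ))) ≤ Real.exp θ * E := by
    rw [show (n + 1) * θ - u * n * (1 - Real.exp (-θ)) = θ + -(κ₁ * n) by rw [hκ₁]; ring,
      Real.exp_add]
    exact mul_le_mul_of_nonneg_left h8 (Real.exp_pos _).le
  have h11 := Real.one_sub_le_exp_neg (u * n * (a + c))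
  have h12 : u * n * (a + c) ≤ 3 * u * (n * a) := by
    have := mul_le_mul_of_nonneg_left (h.c_le hn) hun
    linarith
  set ε := 3 * u * (n * a) + Real.exp θ * E with hε
  have hε0 : 0 ≤ ε := by positivity
  have h13 : (1 - a - b) * (1 - ε) ≤ H :=
    le_trans (mul_le_mul_of_nonneg_left (by linarith) (by linarith)) h3
  -- Since `1 - b ≥ 1/2`, subtracting `a`, or later `1 - P`, costs at most twice as much inside the
  -- factor `1 - b`.
  have h14 : (1 - b) * (1 - 2 * a - ε) ≤ (1 - a - b) * (1 - ε) := by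
    have : 0 ≤ a * (1 - 2 * b) + a * ε := by
      have : 0 ≤ 1 - 2 * b := by linarith
      positivity
    nlinarith
  have h15 : H * (1 - P) ≤ (1 - b) * (2 * (1 - P)) := by
    have : H * (1 - P) ≤ 1 * (1 - P) := mul_le_mul_of_nonneg_right h5 (by linarith)
    nlinarith
  have h16 : a ≤ n * a := by
    have : (1 : ℝ) ≤ n := by exact_mod_cast (by omega : 1 ≤ n)
    nlinarith
  have h17 : 1 - (3 * u + 20 + Real.exp θ) * (n * a + E) ≤ 1 - 2 * a - ε - 2 * (1 - P) := by
    have h18 : 0 ≤ Real.exp θ * (n * a) := by positivity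
    have h19 : 0 ≤ u * E := mul_nonneg (by linarith) hEpos.le
    rw [hε]
    linarith
  have h20 := mul_le_mul_of_nonneg_left h17 (show 0 ≤ 1 - b by linarith)
  linarith

theorem lacoin_slow_travel_before {u : ℝ} (hu0 : 0 < u) (hu : u < 2) : ∃ κ > 0,
    ∀ (n : ℕ) (a b c : ℝ) (π : Fin (2 * n + 1) → ℝ), 2 ≤ n → IsLacoinChain n a b c π →
    ∀ t, 0 ≤ t → t ≤ u * n →
    b * (1 - 2 * (n * a) - Real.exp (-(κ * n))) ≤
      1 - continuousKernel (lacoinKernel n a b c) t 0 (Fin.last (2 * n)) := by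
  obtain ⟨θ, hθ, h1⟩ := exists_mul_exp_sub_one_lt_mul hu0 hu
  refine ⟨2 * θ - u * (Real.exp θ - 1), sub_pos.2 h1, fun n a b c π hn h t ht0 ht => ?_⟩
  have hn0 : (0 : ℝ) ≤ n := Nat.cast_nonneg n
  refine le_trans (mul_le_mul_of_nonneg_left ?_ h.pos_b.le)
    (lacoin_slow_travel hn h.pos_a h.pos_b h.add_lt h.nonneg_c h.add_le hθ.le ht0)
  have h2 := Real.one_sub_le_exp_neg (t * a)
  have h3 : t * a ≤ 2 * n * a := mul_le_mul_of_nonneg_right (by nlinarith) h.pos_a.le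
  have h4 : Real.exp (t * (Real.exp θ - 1) - 2 * n * θ) ≤
      Real.exp (-((2 * θ - u * (Real.exp θ - 1)) * n)) := by
    rw [Real.exp_le_exp]
    have := mul_le_mul_of_nonneg_right ht (show 0 ≤ Real.exp θ - 1 by
      linarith [Real.one_le_exp hθ.le])
    linarith
  linarith

theorem lacoin_fast_travel_before {u : ℝ} (hu0 : 0 < u) (hu : u < 1) : ∃ κ > 0,
    ∀ (n : ℕ) (a b c : ℝ) (π : Fin (2 * n + 1) → ℝ), 2 ≤ n → IsLacoinChain n a b c π →
    continuousKernel (lacoinKernel n a b c) (u * n) 0 (Fin.last (2 * n)) ≤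
      Real.exp (-(κ * n)) := by
  obtain ⟨θ, hθ, h1⟩ := exists_mul_exp_sub_one_lt_mul hu0 hu
  refine ⟨1 * θ - u * (Real.exp θ - 1), sub_pos.2 h1, fun n a b c π hn h => ?_⟩
  refine (lacoin_fast_travel hn h.pos_a h.pos_b h.add_lt h.nonneg_c h.add_le hθ.le
    (mul_nonneg hu0.le (Nat.cast_nonneg n))).trans_eq ?_
  congr 1
  ring

/-! ### Products over the coordinates and limits -/

theorem exp_neg_two_mul_le_one_sub {x : ℝ} (h0 : 0 ≤ x) (h1 : x ≤ 1 / 2) :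
    Real.exp (-(2 * x)) ≤ 1 - x := by
  have h2 : Real.exp (-(2 * x)) ≤ 1 / (1 + 2 * x) := by
    rw [Real.exp_neg, ← one_div]
    exact one_div_le_one_div_of_le (by linarith) (by linarith [Real.add_one_le_exp (2 * x)])
  refine h2.trans ?_
  rw [div_le_iff₀ (by linarith)]
  nlinarith

theorem one_sub_sum_le_prod_one_sub {ι : Type*} (s : Finset ι) (f : ι → ℝ)
    (h0 : ∀ i ∈ s, 0 ≤ f i) (h1 : ∀ i ∈ s, f i ≤ 1) :
    1 - ∑ i ∈ s, f i ≤ ∏ i ∈ s, (1 - f i) := by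
  classical
  induction s using Finset.induction_on with
  | empty => simp
  | insert i s hi ih =>
    rw [Finset.sum_insert hi, Finset.prod_insert hi]
    have h2 := ih (fun j hj => h0 j (Finset.mem_insert_of_mem hj))
      fun j hj => h1 j (Finset.mem_insert_of_mem hj)
    have h3 := h0 i (Finset.mem_insert_self _ _)
    have h4 := h1 i (Finset.mem_insert_self _ _)
    have h5 : ∏ j ∈ s, (1 - f j) ≤ 1 := Finset.prod_le_one
      (fun j hj => sub_nonneg.2 (h1 j (Finset.mem_insert_of_mem hj)))
      (fun j hj => by linarith [h0 j (Finset.mem_insert_of_mem hj)])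
    nlinarith

theorem exp_mul_one_sub_sum_le_prod {ι : Type*} (s : Finset ι) {β ε h : ι → ℝ}
    (hβ0 : ∀ i ∈ s, 0 ≤ β i) (hβ1 : ∀ i ∈ s, β i ≤ 1 / 2) (hε0 : ∀ i ∈ s, 0 ≤ ε i)
    (hε1 : ∑ i ∈ s, ε i ≤ 1) (hh : ∀ i ∈ s, (1 - β i) * (1 - ε i) ≤ h i) :
    Real.exp (-(2 * ∑ i ∈ s, β i)) * (1 - ∑ i ∈ s, ε i) ≤ ∏ i ∈ s, h i := by
  have h1 : ∀ i ∈ s, ε i ≤ 1 := fun i hi => (Finset.single_le_sum hε0 hi).trans hε1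
  have h2 : Real.exp (-(2 * ∑ i ∈ s, β i)) ≤ ∏ i ∈ s, (1 - β i) := by
    rw [Finset.mul_sum, ← Finset.sum_neg_distrib, Real.exp_sum]
    exact Finset.prod_le_prod (fun i _ => (Real.exp_pos _).le) fun i hi =>
      exp_neg_two_mul_le_one_sub (hβ0 i hi) (hβ1 i hi)
  calc Real.exp (-(2 * ∑ i ∈ s, β i)) * (1 - ∑ i ∈ s, ε i)
      ≤ (∏ i ∈ s, (1 - β i)) * ∏ i ∈ s, (1 - ε i) :=
        mul_le_mul h2 (one_sub_sum_le_prod_one_sub s ε hε0 h1) (by linarith)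
          ((Real.exp_pos _).le.trans h2)
    _ = ∏ i ∈ s, ((1 - β i) * (1 - ε i)) := Finset.prod_mul_distrib.symm
    _ ≤ ∏ i ∈ s, h i := Finset.prod_le_prod (fun i hi => mul_nonneg
        (by linarith [hβ1 i hi]) (by linarith [h1 i hi])) hh

theorem tendsto_mul_exp_neg_mul {κ : ℝ} (hκ : 0 < κ) :
    Tendsto (fun n : ℕ => (n : ℝ) * Real.exp (-(κ * n))) atTop (𝓝 0) := by
  have h1 : Tendsto (fun n : ℕ => κ * (n : ℝ)) atTop atTop :=
    tendsto_natCast_atTop_atTop.const_mul_atTop hκ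
  have h2 := ((Real.tendsto_pow_mul_exp_neg_atTop_nhds_zero 1).comp h1).const_mul κ⁻¹
  rw [mul_zero] at h2
  refine h2.congr fun n => ?_
  simp only [Function.comp_apply, pow_one]
  field_simp

theorem tendsto_exp_neg_mul {κ : ℝ} (hκ : 0 < κ) :
    Tendsto (fun n : ℕ => Real.exp (-(κ * n))) atTop (𝓝 0) :=
  Real.tendsto_exp_neg_atTop_nhds_zero.comp (tendsto_natCast_atTop_atTop.const_mul_atTop hκ)

theorem tendsto_mul_of_isLittleO_one_div {f : ℕ → ℝ} (h0 : f 0 = 0)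
    (h : f =o[atTop] (fun n : ℕ => 1 / (n : ℝ))) :
    Tendsto (fun n : ℕ => (n : ℝ) * f n) atTop (𝓝 0) := by
  -- Since `1 / 0 = 0`, the quotient criterion also asks for `f 0 = 0`.
  rw [isLittleO_iff_tendsto fun n hn => ?_] at h
  · refine h.congr fun n => ?_
    rw [div_div_eq_mul_div, div_one, mul_comm]
  · rcases Nat.eq_zero_or_pos n with rfl | hn'
    · exact h0
    · exact absurd hn (by positivity)

/-! ### Distance bounds for the product family -/

section lacoinFamily

variable {p a b c : ∀ n : ℕ, Fin n → ℝ} {π : ∀ n : ℕ, Fin n → Fin (2 * n + 1) → ℝ}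
  (hp : ∀ n i, 0 < p n i)
  (hL : ∀ n i, IsLacoinChain n (a n i) (b n i) (c n i) (π n i))

/-- The time scale `q_n n / p̂_n`. -/
noncomputable def lacoinScale (p : ∀ n : ℕ, Fin n → ℝ) (n : ℕ) : ℝ :=
  lacoinQ p n * n / lacoinPhat p n

include hp

theorem lacoinQ_pos {n : ℕ} (hn : 1 ≤ n) : 0 < lacoinQ p n :=
  have : Nonempty (Fin n) := ⟨⟨0, hn⟩⟩
  Finset.sum_pos (fun i _ => hp n i) Finset.univ_nonempty

omit hp in
theorem lacoinPhat_le (n : ℕ) (i : Fin n) : lacoinPhat p n ≤ p n i :=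
  ciInf_le (Set.finite_range _).bddBelow i

omit hp in
theorem exists_eq_lacoinPhat {n : ℕ} (hn : 1 ≤ n) : ∃ i, p n i = lacoinPhat p n :=
  have : Nonempty (Fin n) := ⟨⟨0, hn⟩⟩
  exists_eq_ciInf_of_finite

theorem lacoinPhat_nonneg (n : ℕ) : 0 ≤ lacoinPhat p n :=
  Real.iInf_nonneg fun i => (hp n i).le

theorem lacoinPhat_pos {n : ℕ} (hn : 1 ≤ n) : 0 < lacoinPhat p n := by
  obtain ⟨i, hi⟩ := exists_eq_lacoinPhat (p := p) hn
  exact hi ▸ hp n i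

theorem lacoinScale_pos {n : ℕ} (hn : 1 ≤ n) : 0 < lacoinScale p n := by
  have h1 := lacoinQ_pos hp hn
  have h2 := lacoinPhat_pos hp hn
  have : (0 : ℝ) < n := by exact_mod_cast hn
  unfold lacoinScale
  positivity

/-- The internal clock of coordinate `i`: at normalised time `s` it shows `s * n` times the ratio of
`p i` to the smallest rate. -/
theorem lacoin_weight_mul {n : ℕ} (hn : 1 ≤ n) (i : Fin n) (s : ℝ) :
    p n i / lacoinQ p n * (s * lacoinScale p n) = s * n * (p n i / lacoinPhat p n) := by
  have h1 := (lacoinQ_pos hp hn).ne'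
  have h2 := (lacoinPhat_pos hp hn).ne'
  unfold lacoinScale
  field_simp

theorem lacoin_sum_weights {n : ℕ} (hn : 1 ≤ n) : ∑ i, p n i / lacoinQ p n = 1 := by
  rw [← Finset.sum_div]
  exact div_self (lacoinQ_pos hp hn).ne'

omit hp in
theorem lacoinB_zero (n : ℕ) : lacoinB p b n 0 = 0 := by
  rw [lacoinB, Finset.sum_filter]
  refine Finset.sum_eq_zero fun i _ => if_neg ?_
  rw [add_zero, one_mul]
  exact (lacoinPhat_le n i).not_gt

omit hp in
include hL in
theorem lacoinB_nonneg (n : ℕ) (δ : ℝ) : 0 ≤ lacoinB p b n δ :=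
  Finset.sum_nonneg fun i _ => (hL n i).pos_b.le

include hL in
theorem lacoinB_mono (n : ℕ) : Monotone (lacoinB p b n) := fun δ δ' h =>
  Finset.sum_le_sum_of_subset_of_nonneg (fun i => by
    simp only [Finset.mem_filter, Finset.mem_univ, true_and]
    intro hi
    exact hi.trans_le (mul_le_mul_of_nonneg_right (by linarith) (lacoinPhat_nonneg hp n)))
    fun i _ _ => (hL n i).pos_b.le

include hL

theorem lacoin_product_isStochastic {n : ℕ} (hn : 1 ≤ n) :
    IsStochastic (productKernel (fun i => p n i / lacoinQ p n)
      (fun i => lacoinKernel n (a n i) (b n i) (c n i))) :=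
  productKernel_isStochastic (fun i => div_nonneg (hp n i).le (lacoinQ_pos hp hn).le)
    (lacoin_sum_weights hp hn) fun i => (hL n i).isStochastic hn

omit hL in
theorem lacoin_product_apply {n : ℕ} (hn : 1 ≤ n) (s : ℝ) (x y : Fin n → Fin (2 * n + 1)) :
    continuousKernel (productKernel (fun i => p n i / lacoinQ p n)
      (fun i => lacoinKernel n (a n i) (b n i) (c n i))) (s * lacoinScale p n) x y =
      ∏ i, continuousKernel (lacoinKernel n (a n i) (b n i) (c n i))
        (s * n * (p n i / lacoinPhat p n)) (x i) (y i) := by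
  rw [continuousKernel_productKernel (lacoin_sum_weights hp hn)]
  simp only [tensorMatrix, lacoin_weight_mul hp hn]

omit hp hL in
theorem lacoinTV_nonneg (n : ℕ) (t : ℝ) : 0 ≤ lacoinTV p a b c π n t :=
  continuousTV_nonneg _ _ _

theorem lacoinTV_le_one {n : ℕ} (hn : 1 ≤ n) {t : ℝ} (ht : 0 ≤ t) :
    lacoinTV p a b c π n t ≤ 1 :=
  continuousTV_le_one (lacoin_product_isStochastic hp hL hn)
    (productDistribution_nonneg fun i => (hL n i).stationary.1) ht

theorem lacoinTV_anti {n : ℕ} (hn : 1 ≤ n) {s t : ℝ} (hst : s ≤ t) :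
    lacoinTV p a b c π n t ≤ lacoinTV p a b c π n s :=
  continuousTV_anti (lacoin_product_isStochastic hp hL hn) hst

omit hL in
theorem lacoin_le_time {n : ℕ} (hn : 1 ≤ n) {s δ : ℝ} (hs : 0 ≤ s) {i : Fin n}
    (hi : (1 + δ) * lacoinPhat p n ≤ p n i) :
    s * (1 + δ) * n ≤ s * n * (p n i / lacoinPhat p n) := by
  rw [mul_right_comm]
  exact mul_le_mul_of_nonneg_left ((le_div_iff₀ (lacoinPhat_pos hp hn)).2 hi)
    (mul_nonneg hs (Nat.cast_nonneg n))

/-- Upper bound for the total variation at times above the fast travel time. -/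
theorem lacoinTV_le (hsum : (fun n : ℕ => ∑ i, a n i) =o[atTop] (fun n : ℕ => 1 / (n : ℝ)))
    {s δ : ℝ} (hs : 1 < s) (hδ : 2 < s * (1 + δ)) :
    ∃ e : ℕ → ℝ, Tendsto e atTop (𝓝 0) ∧ ∀ᶠ n in atTop,
      lacoinTV p a b c π n (s * lacoinScale p n) ≤
        1 - Real.exp (-(2 * lacoinB p b n δ)) * (1 - e n) := by
  obtain ⟨C₁, hC₁, κ₁, hκ₁, h1⟩ := lacoin_slow_arrival_after hδ
  obtain ⟨C₂, hC₂, κ₂, hκ₂, h2⟩ := lacoin_fast_arrival_after hs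
  obtain ⟨κ₃, hκ₃, h3⟩ := lacoin_stationary_last_ge
  set C := C₁ + C₂ + 9 with hC
  set κ := min κ₁ (min κ₂ κ₃) with hκ
  have hκ0 : 0 < κ := lt_min hκ₁ (lt_min hκ₂ hκ₃)
  -- The sum of the coordinate errors `ε i`; it vanishes in the limit because `∑ a = o(1/n)` and `n
  -- * exp (-κ n) → 0`.
  set e : ℕ → ℝ := fun n => C * ((n : ℝ) * ∑ i, a n i + n * Real.exp (-(κ * n))) with he
  have he0 : Tendsto e atTop (𝓝 0) := by
    have := ((tendsto_mul_of_isLittleO_one_div (by simp) hsum).add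
      (tendsto_mul_exp_neg_mul hκ0)).const_mul C
    simpa using this
  refine ⟨e, he0, ?_⟩
  filter_upwards [eventually_ge_atTop 2, he0.eventually (gt_mem_nhds one_pos)] with n hn hen
  have hn1 : 1 ≤ n := by omega
  -- Only coordinates with `p i < (1 + δ) p̂` may still be on the slow route; the others have run
  -- for `s * (1 + δ) * n > 2n` and pay nothing.
  set β : Fin n → ℝ := fun i => if p n i < (1 + δ) * lacoinPhat p n then b n i else 0 with hβ
  set ε : Fin n → ℝ := fun i => C * (n * a n i + Real.exp (-(κ * n))) with hε
  have hβsum : ∑ i, β i = lacoinB p b n δ := (Finset.sum_filter _ _).symm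
  have hεsum : ∑ i, ε i = e n := by
    simp only [hε, he, ← Finset.mul_sum, Finset.sum_add_distrib, Finset.sum_const,
      Finset.card_univ, Fintype.card_fin, nsmul_eq_mul]
  have hβ0 : ∀ i, 0 ≤ β i := fun i => by
    simp only [hβ]
    split_ifs
    exacts [(hL n i).pos_b.le, le_rfl]
  have hβ1 : ∀ i, β i ≤ 1 / 2 := fun i => by
    simp only [hβ]
    split_ifs
    exacts [by linarith [(hL n i).pos_a, (hL n i).add_lt], by norm_num]
  have hn0 : (0 : ℝ) ≤ n := Nat.cast_nonneg n
  have hε0 : ∀ i, 0 ≤ ε i := fun i => by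
    have := (hL n i).pos_a
    positivity
  have hεge : ∀ (i : Fin n) (C' κ' : ℝ), 0 ≤ C' → C' ≤ C → κ ≤ κ' →
      C' * (n * a n i + Real.exp (-(κ' * n))) ≤ ε i := by
    intro i C' κ' h0 h4 h5
    have := (hL n i).pos_a
    exact mul_le_mul h4 (by linarith [exp_neg_mul_le h5 n]) (by positivity) (h0.trans h4)
  have hβ1' : ∀ i, 0 ≤ 1 - β i := fun i => by linarith [hβ1 i]
  have hε1 : ∀ i, ε i ≤ 1 := fun i =>
    (Finset.single_le_sum (fun j _ => hε0 j) (Finset.mem_univ i)).trans (hεsum ▸ hen.le)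
  have hHi : ∀ (i : Fin n) (x : Fin (2 * n + 1)), (1 - β i) * (1 - ε i) ≤
      continuousKernel (lacoinKernel n (a n i) (b n i) (c n i))
        (s * n * (p n i / lacoinPhat p n)) x (Fin.last (2 * n)) := by
    intro i x
    by_cases hi : p n i < (1 + δ) * lacoinPhat p n
    · have hβi : β i = b n i := if_pos hi
      have h4 : s * n ≤ s * n * (p n i / lacoinPhat p n) := by
        have := lacoin_le_time hp hn1 (s := s) (δ := 0) (by linarith) (i := i)
          (by simpa using lacoinPhat_le n i)
        simpa using this
      refine le_trans ?_ (h2 n _ _ _ _ hn (hL n i) x _ h4)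
      rw [← hβi]
      refine mul_le_mul_of_nonneg_left ?_ (hβ1' i)
      linarith [hεge i C₂ κ₂ hC₂.le (by linarith)
        ((min_le_right _ _).trans (min_le_left _ _))]
    · have hβi : β i = 0 := if_neg hi
      have h4 := lacoin_le_time hp hn1 (s := s) (by linarith) (not_lt.1 hi)
      refine le_trans ?_ (h1 n _ _ _ _ hn (hL n i) x _ h4)
      rw [hβi, sub_zero, one_mul]
      linarith [hεge i C₁ κ₁ hC₁.le (by linarith) (min_le_left _ _)]
  have hπi : ∀ i : Fin n, (1 - β i) * (1 - ε i) ≤ π n i (Fin.last (2 * n)) := by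
    intro i
    refine (mul_le_of_le_one_left (by linarith [hε1 i]) (by linarith [hβ0 i])).trans ?_
    have h4 := hεge i 9 κ₃ (by norm_num) (by linarith)
      ((min_le_right _ _).trans (min_le_right _ _))
    linarith [h3 n _ _ _ _ hn (hL n i), Real.exp_pos (-(κ₃ * n))]
  have hpos : 0 ≤ s * lacoinScale p n :=
    mul_nonneg (by linarith) (lacoinScale_pos hp hn1).le
  rw [← hβsum, ← hεsum]
  refine continuousTV_le_of_forall (lacoin_product_isStochastic hp hL hn1)
    (productDistribution_nonneg fun i => (hL n i).stationary.1) hpos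
    (fun _ => Fin.last (2 * n)) ?_ fun x => ?_
  · exact exp_mul_one_sub_sum_le_prod _ (fun i _ => hβ0 i) (fun i _ => hβ1 i)
      (fun i _ => hε0 i) (hεsum ▸ hen.le) fun i _ => hπi i
  · rw [lacoin_product_apply hp hn1]
    exact exp_mul_one_sub_sum_le_prod _ (fun i _ => hβ0 i) (fun i _ => hβ1 i)
      (fun i _ => hε0 i) (hεsum ▸ hen.le) fun i _ => hHi i (x i)

omit hp in
/-- The stationary distribution concentrates at `(2n, …, 2n)`. -/
theorem lacoin_product_stationary_ge
    (hsum : (fun n : ℕ => ∑ i, a n i) =o[atTop] (fun n : ℕ => 1 / (n : ℝ))) :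
    ∃ e : ℕ → ℝ, Tendsto e atTop (𝓝 0) ∧ ∀ᶠ n in atTop,
      1 - e n ≤ productDistribution (π n) fun _ => Fin.last (2 * n) := by
  obtain ⟨κ, hκ, h1⟩ := lacoin_stationary_last_ge
  set e : ℕ → ℝ := fun n => 9 * ((n : ℝ) * ∑ i, a n i) + n * Real.exp (-(κ * n)) with he
  have he0 : Tendsto e atTop (𝓝 0) := by
    have := ((tendsto_mul_of_isLittleO_one_div (by simp) hsum).const_mul 9).add
      (tendsto_mul_exp_neg_mul hκ)
    simpa using this
  refine ⟨e, he0, ?_⟩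
  filter_upwards [eventually_ge_atTop 2, he0.eventually (gt_mem_nhds one_pos)] with n hn hen
  have hεsum : ∑ i, (9 * (n * a n i) + Real.exp (-(κ * n))) = e n := by
    simp only [he, ← Finset.mul_sum, Finset.sum_add_distrib, Finset.sum_const,
      Finset.card_univ, Fintype.card_fin, nsmul_eq_mul]
  have h2 := exp_mul_one_sub_sum_le_prod Finset.univ (β := fun _ => 0)
    (ε := fun i => 9 * (n * a n i) + Real.exp (-(κ * n)))
    (h := fun i => π n i (Fin.last (2 * n))) (fun i _ => le_rfl) (fun i _ => by norm_num)
    (fun i _ => by have := (hL n i).pos_a; positivity) (hεsum ▸ hen.le) fun i _ => by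
      linarith [h1 n _ _ _ _ hn (hL n i)]
  simpa [hεsum, productDistribution] using h2

/-- Lower bound for the total variation at times below the slow travel time. -/
theorem le_lacoinTV (hsum : (fun n : ℕ => ∑ i, a n i) =o[atTop] (fun n : ℕ => 1 / (n : ℝ)))
    {s δ : ℝ} (hs : 0 < s) (hδ : s * (1 + δ) < 2) :
    ∃ e : ℕ → ℝ, Tendsto e atTop (𝓝 0) ∧ ∀ᶠ n in atTop,
      1 - e n - Real.exp (-(lacoinB p b n δ / 2)) ≤
        lacoinTV p a b c π n (s * lacoinScale p n) := by
  obtain ⟨e, he, hπ⟩ := lacoin_product_stationary_ge hL hsum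
  -- `δ` is arbitrary, so `s * (1 + δ)` need not be positive; the maximum with `1` is, and remains
  -- below `2`.
  obtain ⟨κ, hκ, h1⟩ := lacoin_slow_travel_before (u := max (s * (1 + δ)) 1)
    (lt_max_of_lt_right one_pos) (max_lt hδ one_lt_two)
  refine ⟨e, he, ?_⟩
  have hν : Tendsto (fun n : ℕ => 2 * ((n : ℝ) * ∑ i, a n i) + Real.exp (-(κ * n)))
      atTop (𝓝 0) := by
    have := ((tendsto_mul_of_isLittleO_one_div (by simp) hsum).const_mul 2).add
      (tendsto_exp_neg_mul hκ)
    simpa using this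
  filter_upwards [eventually_ge_atTop 2, hπ, hν.eventually (gt_mem_nhds one_half_pos)]
    with n hn hπn hνn
  have hn1 : 1 ≤ n := by omega
  have hn0 : (0 : ℝ) ≤ n := Nat.cast_nonneg n
  have hpos : 0 ≤ s * lacoinScale p n := mul_nonneg hs.le (lacoinScale_pos hp hn1).le
  have h2 := sub_le_continuousTV (π := productDistribution (π n))
    (lacoin_product_isStochastic hp hL hn1)
    (sum_productDistribution fun i => (hL n i).stationary.2.1) hpos
    (fun _ => (0 : Fin (2 * n + 1))) (fun _ => Fin.last (2 * n))
  rw [lacoin_product_apply hp hn1] at h2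
  have h3 : ∏ i, continuousKernel (lacoinKernel n (a n i) (b n i) (c n i))
      (s * n * (p n i / lacoinPhat p n)) 0 (Fin.last (2 * n)) ≤
      Real.exp (-(lacoinB p b n δ / 2)) := by
    have h4 : Real.exp (-(lacoinB p b n δ / 2)) =
        ∏ i, Real.exp (-((if p n i < (1 + δ) * lacoinPhat p n then b n i else 0) / 2)) := by
      rw [← Real.exp_sum, Finset.sum_neg_distrib, ← Finset.sum_div, ← Finset.sum_filter]
      rfl
    rw [h4]
    have ht : ∀ i, 0 ≤ s * n * (p n i / lacoinPhat p n) := fun i =>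
      mul_nonneg (mul_nonneg hs.le hn0) (div_nonneg (hp n i).le (lacoinPhat_nonneg hp n))
    refine Finset.prod_le_prod (fun i _ =>
      (((hL n i).isStochastic hn1).continuousKernel (ht i)).1 _ _) fun i _ => ?_
    split_ifs with hi
    · have h5 : s * n * (p n i / lacoinPhat p n) ≤ max (s * (1 + δ)) 1 * n := by
        refine le_trans ?_ (mul_le_mul_of_nonneg_right (le_max_left _ _) hn0)
        rw [mul_right_comm s (1 + δ)]
        exact mul_le_mul_of_nonneg_left ((div_le_iff₀ (lacoinPhat_pos hp hn1)).2 hi.le)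
          (mul_nonneg hs.le hn0)
      have h6 := h1 n _ _ _ _ hn (hL n i) _ (ht i) h5
      have h7 : a n i ≤ ∑ j, a n j :=
        Finset.single_le_sum (fun j _ => (hL n j).pos_a.le) (Finset.mem_univ i)
      -- A coordinate counted by `B` is thus missing from `2n` with probability at least `b / 2`,
      -- and `1 - b / 2 ≤ exp (-b / 2)` gives the exponential.
      have h8 : 1 / 2 ≤ 1 - 2 * (n * a n i) - Real.exp (-(κ * n)) := by
        have := mul_le_mul_of_nonneg_left h7 hn0
        linarith
      have h9 := mul_le_mul_of_nonneg_left h8 (hL n i).pos_b.le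
      have h10 := Real.one_sub_le_exp_neg (b n i / 2)
      linarith
    · simpa using (((hL n i).isStochastic hn1).continuousKernel (ht i)).le_one 0
        (Fin.last (2 * n))
  have h5 : productDistribution (π n) (fun _ => Fin.last (2 * n)) -
    ∏ i, continuousKernel (lacoinKernel n (a n i) (b n i) (c n i))
      (s * n * (p n i / lacoinPhat p n)) 0 (Fin.last (2 * n)) ≤
      lacoinTV p a b c π n (s * lacoinScale p n) := h2
  linarith

theorem lacoinTV_tendsto_one
    (hsum : (fun n : ℕ => ∑ i, a n i) =o[atTop] (fun n : ℕ => 1 / (n : ℝ)))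
    {s : ℝ} (hs : 0 < s) (hs1 : s < 1) :
    Tendsto (fun n => lacoinTV p a b c π n (s * lacoinScale p n)) atTop (𝓝 1) := by
  obtain ⟨e, he, hπ⟩ := lacoin_product_stationary_ge hL hsum
  obtain ⟨κ, hκ, h1⟩ := lacoin_fast_travel_before hs hs1
  have hlim : Tendsto (fun n : ℕ => 1 - e n - Real.exp (-(κ * n))) atTop (𝓝 1) := by
    simpa using (he.const_sub 1).sub (tendsto_exp_neg_mul hκ)
  refine tendsto_of_tendsto_of_tendsto_of_le_of_le' hlim tendsto_const_nhds ?_ ?_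
  · filter_upwards [eventually_ge_atTop 2, hπ] with n hn hπn
    have hn1 : 1 ≤ n := by omega
    have hn0 : (0 : ℝ) ≤ n := Nat.cast_nonneg n
    have hpos : 0 ≤ s * lacoinScale p n := mul_nonneg hs.le (lacoinScale_pos hp hn1).le
    have h2 := sub_le_continuousTV (π := productDistribution (π n))
      (lacoin_product_isStochastic hp hL hn1)
      (sum_productDistribution fun i => (hL n i).stationary.2.1) hpos
      (fun _ => (0 : Fin (2 * n + 1))) (fun _ => Fin.last (2 * n))
    rw [lacoin_product_apply hp hn1] at h2
    obtain ⟨i₀, hi₀⟩ := exists_eq_lacoinPhat (p := p) hn1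
    have ht : ∀ i, 0 ≤ s * n * (p n i / lacoinPhat p n) := fun i =>
      mul_nonneg (mul_nonneg hs.le hn0) (div_nonneg (hp n i).le (lacoinPhat_nonneg hp n))
    have hst := fun i => ((hL n i).isStochastic hn1).continuousKernel (ht i)
    have h3 : ∏ i, continuousKernel (lacoinKernel n (a n i) (b n i) (c n i))
        (s * n * (p n i / lacoinPhat p n)) 0 (Fin.last (2 * n)) ≤ Real.exp (-(κ * n)) := by
      -- The slowest coordinate alone suffices: its clock shows `s * n < n`, and the other factors
      -- are at most `1`.
      rw [← Finset.mul_prod_erase _ _ (Finset.mem_univ i₀)]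
      refine (mul_le_of_le_one_right ((hst i₀).1 _ _) (Finset.prod_le_one
        (fun i _ => (hst i).1 _ _) fun i _ => (hst i).le_one _ _)).trans ?_
      rw [hi₀, div_self (lacoinPhat_pos hp hn1).ne', mul_one]
      exact h1 n _ _ _ _ hn (hL n i₀)
    have h5 : productDistribution (π n) (fun _ => Fin.last (2 * n)) -
      ∏ i, continuousKernel (lacoinKernel n (a n i) (b n i) (c n i))
        (s * n * (p n i / lacoinPhat p n)) 0 (Fin.last (2 * n)) ≤
        lacoinTV p a b c π n (s * lacoinScale p n) := h2
    linarith
  · filter_upwards [eventually_ge_atTop 1] with n hn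
    exact lacoinTV_le_one hp hL hn (mul_nonneg hs.le (lacoinScale_pos hp hn).le)

theorem lacoin_isCutoffProfile
    (hsum : (fun n : ℕ => ∑ i, a n i) =o[atTop] (fun n : ℕ => 1 / (n : ℝ)))
    {ξ : ℕ → ℕ} (hξ : IsSubsequence ξ) :
    IsCutoffProfile (fun k s => lacoinTV p a b c π (ξ k) (s * lacoinScale p (ξ k)))
      (fun k => lacoinB p b (ξ k)) where
  anti k s t _ hst :=
    have hT := (lacoinScale_pos hp (hξ.2 k)).le
    lacoinTV_anti hp hL (hξ.2 k) (mul_le_mul_of_nonneg_right hst hT)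
  nonneg k s _ := lacoinTV_nonneg _ _
  le_one k s hs := lacoinTV_le_one hp hL (hξ.2 k)
    (mul_nonneg hs (lacoinScale_pos hp (hξ.2 k)).le)
  mono k := lacoinB_mono hp hL _
  nonneg_B k := lacoinB_nonneg hL _
  zero_B k := lacoinB_zero _
  early s h0 h1 := (lacoinTV_tendsto_one hp hL hsum h0 h1).comp hξ.1.tendsto_atTop
  upper s δ h0 h1 := by
    obtain ⟨e, he, hd⟩ := lacoinTV_le hp hL hsum h0 h1
    exact ⟨fun k => e (ξ k), he.comp hξ.1.tendsto_atTop, hξ.1.tendsto_atTop.eventually hd⟩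
  lower s δ h0 h1 := by
    obtain ⟨e, he, hd⟩ := le_lacoinTV hp hL hsum h0 h1
    exact ⟨fun k => e (ξ k), he.comp hξ.1.tendsto_atTop, hξ.1.tendsto_atTop.eventually hd⟩

end lacoinFamily

/-! ### Change of time units and the final equivalences -/

/-- Cutoffs do not depend on the choice of time units. -/
theorem isCutoffTime_rescale {d : ℕ → ℝ → ℝ} {T s : ℕ → ℝ} (hT : ∀ k, 0 < T k) :
    IsCutoffTime (fun k u => d k (u * T k)) s ↔ IsCutoffTime d fun k => s k * T k := by
  simp only [IsCutoffTime, mul_assoc, mul_pos_iff_of_pos_right (hT _)]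

theorem hasCutoff_rescale {d : ℕ → ℝ → ℝ} {T : ℕ → ℝ} (hT : ∀ k, 0 < T k) :
    HasCutoff (fun k u => d k (u * T k)) ↔ HasCutoff d := by
  refine ⟨fun ⟨s, hs⟩ => ⟨_, (isCutoffTime_rescale hT).1 hs⟩, fun ⟨t, ht⟩ =>
    ⟨fun k => t k / T k, (isCutoffTime_rescale hT).2 ?_⟩⟩
  have : (fun k => t k / T k * T k) = t := funext fun k => div_mul_cancel₀ _ (hT k).ne'
  rwa [this]

theorem IsSubsequence.comp {ξ φ : ℕ → ℕ} (hξ : IsSubsequence ξ) (hφ : StrictMono φ) :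
    IsSubsequence fun k => ξ (φ k) :=
  ⟨hξ.1.comp hφ, fun k => hξ.2 (φ k)⟩

/-- The arrays are indexed by `n ≥ 1` and `i : Fin n`; the family `𝒢` itself is the sequence
`k ↦ 𝒢_{k+1}`, and the subfamily along `ξ` is the sequence `k ↦ 𝒢_{ξ k}`. -/
theorem proposition5p8
    (p a b c : ∀ n : ℕ, Fin n → ℝ)
    (π : ∀ n : ℕ, Fin n → Fin (2 * n + 1) → ℝ)
    (hp : ∀ n i, 0 < p n i)
    (ha : ∀ n i, 0 < a n i)
    (hab : ∀ n i, a n i < b n i)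
    (hab' : ∀ n i, a n i + b n i < 1 / 2)
    (hc : ∀ n i, 0 ≤ c n i)
    (hac : ∀ n i, a n i + c n i ≤ 1)
    (hπ : ∀ n i, IsStationaryDistribution (lacoinKernel n (a n i) (b n i) (c n i)) (π n i))
    (hrev : ∀ n i, IsReversibleChain (lacoinKernel n (a n i) (b n i) (c n i)) (π n i))
    (hsum : (fun n : ℕ => ∑ i, a n i) =o[atTop] (fun n : ℕ => 1 / (n : ℝ)))
    (hmax : (fun n : ℕ => ⨆ i, b n i) =o[atTop] (fun _ : ℕ => (1 : ℝ)))
    (hratio : (fun n : ℕ => ⨆ i, a n i / b n i) =O[atTop] (fun n : ℕ => 1 / (n : ℝ))) :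
    -- criterion for a cutoff
    [ ∀ ξ, IsSubsequence ξ →
        thresholdZero (upperF p b ξ) = thresholdInfty (upperF p b ξ) ∧
        thresholdZero (lowerF p b ξ) = thresholdInfty (lowerF p b ξ),
      ∀ ξ, IsSubsequence ξ →
        thresholdZero (upperF p b ξ) = thresholdInfty (upperF p b ξ) ∨
        thresholdZero (lowerF p b ξ) = thresholdInfty (lowerF p b ξ),
      HasCutoff (fun k => lacoinTV p a b c π (k + 1)) ].TFAE ∧
    -- the cutoff time, when the outer thresholds of the whole family agree
    (∀ Δ : ℝ,
      thresholdZero (upperF p b (fun k => k + 1)) = Δ →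
      thresholdInfty (lowerF p b (fun k => k + 1)) = Δ →
      IsCutoffTime (fun k => lacoinTV p a b c π (k + 1))
        (fun k => 2 * (1 + Δ)⁻¹ * (lacoinQ p (k + 1) * ((k + 1 : ℕ) : ℝ)
          / lacoinPhat p (k + 1)))) ∧
    -- the cutoff time, when there is a cutoff and the inner thresholds agree
    (∀ Δ : ℝ,
      HasCutoff (fun k => lacoinTV p a b c π (k + 1)) →
      thresholdZero (lowerF p b (fun k => k + 1)) = Δ →
      thresholdInfty (upperF p b (fun k => k + 1)) = Δ →
      IsCutoffTime (fun k => lacoinTV p a b c π (k + 1))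
        (fun k => 2 * (1 + Δ)⁻¹ * (lacoinQ p (k + 1) * ((k + 1 : ℕ) : ℝ)
          / lacoinPhat p (k + 1)))) ∧
    -- criterion for the absence of cutoffs in all subfamilies
    [ ∀ ξ, IsSubsequence ξ →
        thresholdZero (upperF p b ξ) < thresholdInfty (upperF p b ξ) ∧
        thresholdZero (lowerF p b ξ) < thresholdInfty (lowerF p b ξ),
      ∀ ξ, IsSubsequence ξ →
        thresholdZero (upperF p b ξ) < thresholdInfty (upperF p b ξ) ∨
        thresholdZero (lowerF p b ξ) < thresholdInfty (lowerF p b ξ),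
      ∀ ξ, IsSubsequence ξ →
        ¬ HasCutoff (fun k => lacoinTV p a b c π (ξ k)) ].TFAE := by
  have hL : ∀ n i, IsLacoinChain n (a n i) (b n i) (c n i) (π n i) := fun n i =>
    ⟨ha n i, hab n i, hab' n i, hc n i, hac n i, hπ n i, hrev n i⟩
  have hsucc : IsSubsequence fun k => k + 1 :=
    ⟨fun i j h => Nat.succ_lt_succ h, fun k => Nat.succ_le_succ (Nat.zero_le k)⟩
  have hprof : ∀ ξ, IsSubsequence ξ → IsCutoffProfile
      (fun k s => lacoinTV p a b c π (ξ k) (s * lacoinScale p (ξ k)))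
      (fun k => lacoinB p b (ξ k)) := fun ξ hξ => lacoin_isCutoffProfile hp hL hsum hξ
  have hscale : ∀ ξ, IsSubsequence ξ → ∀ k, 0 < lacoinScale p (ξ k) :=
    fun ξ hξ k => lacoinScale_pos hp (hξ.2 k)
  have hmonoU : ∀ ξ, IsSubsequence ξ → Monotone (upperF p b ξ) :=
    fun ξ hξ => limsupFun_mono (hprof ξ hξ).mono
  have hmonoL : ∀ ξ, IsSubsequence ξ → Monotone (lowerF p b ξ) :=
    fun ξ hξ => liminfFun_mono (hprof ξ hξ).mono
  have hext : ∀ ξ, IsSubsequence ξ →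
      (thresholdZero (upperF p b ξ) = thresholdInfty (upperF p b ξ) ∨
        thresholdZero (lowerF p b ξ) = thresholdInfty (lowerF p b ξ)) →
      ∃ φ : ℕ → ℕ, StrictMono φ ∧
        ∃ Δ, HasSharpThreshold (fun k => lacoinB p b (ξ (φ k))) Δ := by
    rintro ξ hξ (h | h)
    · exact exists_hasSharpThreshold_of_limsup (hprof ξ hξ).mono (hprof ξ hξ).nonneg_B h
    · exact exists_hasSharpThreshold_of_liminf (hprof ξ hξ).mono (hprof ξ hξ).nonneg_B h
  have hcut : ∀ ξ, IsSubsequence ξ → HasCutoff (fun k => lacoinTV p a b c π (ξ k)) →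
      thresholdZero (upperF p b ξ) = thresholdInfty (upperF p b ξ) ∧
        thresholdZero (lowerF p b ξ) = thresholdInfty (lowerF p b ξ) := by
    intro ξ hξ h
    have h' := (hasCutoff_rescale (d := fun k => lacoinTV p a b c π (ξ k)) (hscale ξ hξ)).2 h
    exact ⟨(hprof ξ hξ).limsup_thresholds_eq h', (hprof ξ hξ).liminf_thresholds_eq h'⟩
  have htime : ∀ ξ, IsSubsequence ξ → ∀ Δ,
      HasSharpThreshold (fun k => lacoinB p b (ξ k)) Δ →
      IsCutoffTime (fun k => lacoinTV p a b c π (ξ k))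
        (fun k => 2 / (1 + Δ) * lacoinScale p (ξ k)) := by
    intro ξ hξ Δ hΔ
    refine (isCutoffTime_rescale (d := fun k => lacoinTV p a b c π (ξ k)) (hscale ξ hξ)).1 ?_
    exact (hprof ξ hξ).isCutoffTime hΔ (fun _ => div_pos two_pos (by linarith [hΔ.nonneg]))
      tendsto_const_nhds
  have houter : ∀ Δ : ℝ,
      thresholdZero (upperF p b (fun k => k + 1)) = Δ →
      thresholdInfty (lowerF p b (fun k => k + 1)) = Δ →
      IsCutoffTime (fun k => lacoinTV p a b c π (k + 1))
        (fun k => 2 * (1 + Δ)⁻¹ * (lacoinQ p (k + 1) * ((k + 1 : ℕ) : ℝ)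
          / lacoinPhat p (k + 1))) := fun Δ h0 h1 =>
    htime _ hsucc Δ (hasSharpThreshold_of_outer (hprof _ hsucc).mono (hprof _ hsucc).nonneg_B h0 h1)
  refine ⟨?_, houter, ?_, ?_⟩
  · tfae_have 1 → 2 := fun h ξ hξ => Or.inl (h ξ hξ).1
    tfae_have 2 → 3 := by
      intro h
      refine (hasCutoff_rescale (d := fun k => lacoinTV p a b c π (k + 1))
        (hscale _ hsucc)).1 ((hprof _ hsucc).hasCutoff_of_subseq fun φ hφ => ?_)
      exact hext _ (hsucc.comp hφ) (h _ (hsucc.comp hφ))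
    tfae_have 3 → 1 := by
      rintro ⟨t, ht⟩ ξ hξ
      -- The whole family is indexed by `k + 1`, so the member `ξ k` has index `ξ k - 1`.
      refine hcut ξ hξ ⟨fun k => t (ξ k - 1), fun k => ht.1 _, fun r hr => ?_, fun r h0 h1 => ?_⟩
      all_goals
        have hlim : Tendsto (fun k => ξ k - 1) atTop atTop :=
          (tendsto_sub_atTop_nat 1).comp hξ.1.tendsto_atTop
        have heq : ∀ k, ξ k - 1 + 1 = ξ k := fun k => Nat.sub_add_cancel (hξ.2 k)
      · simpa only [Function.comp_def, heq] using (ht.2.1 r hr).comp hlim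
      · simpa only [Function.comp_def, heq] using (ht.2.2 r h0 h1).comp hlim
    tfae_finish
  · intro Δ hc h0 h1
    -- The cutoff identifies the two thresholds of each limit, so agreement of the inner ones gives
    -- agreement of the outer ones.
    obtain ⟨h2, h3⟩ := hcut _ hsucc hc
    exact houter Δ (h2.trans h1) (h3.symm.trans h0)
  · tfae_have 1 → 2 := fun h ξ hξ => Or.inl (h ξ hξ).1
    tfae_have 2 → 3 := by
      intro h ξ hξ hc
      obtain ⟨h1, h2⟩ := hcut ξ hξ hc
      exact (h ξ hξ).elim h1.not_lt h2.not_lt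
    tfae_have 3 → 1 := by
      intro h ξ hξ
      have key : ¬ (thresholdZero (upperF p b ξ) = thresholdInfty (upperF p b ξ) ∨
          thresholdZero (lowerF p b ξ) = thresholdInfty (lowerF p b ξ)) := by
        intro heq
        -- A single equality already gives a further subsequence with a sharp threshold, hence a
        -- subfamily with a cutoff.
        obtain ⟨φ, hφ, Δ, hΔ⟩ := hext ξ hξ heq
        exact h _ (hξ.comp hφ) ⟨_, htime _ (hξ.comp hφ) Δ hΔ⟩
      rw [not_or] at key
      exact ⟨(thresholdZero_le_thresholdInfty (hmonoU ξ hξ)).lt_of_ne key.1,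
        (thresholdZero_le_thresholdInfty (hmonoL ξ hξ)).lt_of_ne key.2⟩
    tfae_finish
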